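/- **Conventions.** A partition is *super-distinct* if any two of its parts differ by at least $2$; the empty partition is super-distinct. $(a^b)$ is the partition consisting of $b$ parts equal to $a$. For a partition $\lambda$, write $z\in\lambda$ if $z$ is a part of $\lambda$, and for $u\ge 1$ let $z_u=z_{u,\lambda}$ be the largest part of $\lambda$ that is at most $u$; a condition on $z_{u}$ includes the condition that such a part exists. For $n\ge 0$ let: * $\mathcal S_1(n)$ be the set of pairs $(\lambda,(a^b))$ such that $\lambda$ is a super-distinct partition with parts greater than $1$, $a\equiv\pm2\pmod 5$, $b\ge1$, and $|\lambda|+ab=n$; * $\mathcal S_2(n)$ be the set of pairs $(\mu,c)$ where $\mu$ is a super-distinct partition of $n$ with parts greater than $1$ and $c$ is a part of $\mu$ (the marked part). **The map $\psi$.** For $(\mu,c)\in\mathcal S_2(n)$ let $x$ be the largest part of $\mu$ less than $c$ ($x=0$ if there is none), $y=c-x$, and $\widetilde\mu=\mu\setminus\{c\}$. If $x\ne0$, let $\mu^{+d}=(\widetilde\mu\setminus\{x\})\cup\{x+d\}$. Define $\psi(\mu,c)$ as follows. 1. If $c=2k$: $(\widetilde\mu,(2^k))$. 2. If $c$ is odd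 and $c\equiv\pm2\pmod5$: $(\widetilde\mu,(c))$. 3. If $c=2k+1\not\equiv\pm2\pmod5$ and $y\in\{2,3\}$ (then $x\neq 0$): $(\mu^{+1},(2^k))$. 4. If $c=10j+5$ and $y\ge4$: $(\mu^{+1},((5j+2)^2))$ if $x\ne0$; $(\widetilde\mu\cup\{5j+3\},(5j+2))$ if $x=0$. 5. If $c=10j+9$ and $y\ge4$: $(\mu^{+3},((5j+3)^2))$ if $x\ne0$; $(\widetilde\mu\cup\{3\},((5j+3)^2))$ if $x=0$. 6. If $c=20h+11$ and $y\ge4$: for $h>0$, $(\mu^{+3},((5h+2)^4))$ if $x\ne0$ and $(\widetilde\mu\cup\{3\},((5h+2)^4))$ if $x=0$; for $h=0$, $(\mu^{+2},(3^3))$ if $x\ne0$ and $(\widetilde\mu\cup\{2\},(3^3))$ if $x=0$. 7. If $c=20h+1$ ($h\ge1$) and $y\ge4$, write $c=3m+r$ with $0\le r\le2$: $(\mu^{+r},(3^m))$ if $x\ne0$; $(\widetilde\mu,(3^m))$ if $x=0,r=0$; $(\widetilde\mu\cup\{2\},(3^m))$ if $x=0,r=2$; $(\widetilde\mu\cup\{5h+3,5h+1,5h-1\},(5h-2))$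 if $x=0,r=1$. **The sets $\mathcal I_j(n)$.** Each is the set of all pairs in $\mathcal S_1(n)$ of one of the listed forms. * $\mathcal I_1(n)$: $(\lambda,(2^k))$ with $2k-1,2k,2k+1\notin\lambda$. * $\mathcal I_2(n)$: $(\lambda,(a))$ with $a$ odd and $a-1,a,a+1\notin\lambda$. * $\mathcal I_3(n)$: $(\lambda,(2^k))$ with $k\ge2$, $2k+1\not\equiv\pm2\pmod5$, and either $2k\in\lambda$ and $2k-2,2k+2\notin\lambda$, or $2k-1\in\lambda$ and $2k-3,2k+1,2k+2\notin\lambda$. * $\mathcal I_4(n)$: (a) $(\lambda,(a^2))$ with $a>2$, $a\equiv2\pmod5$, $2a-1,2a,2a+1,2a+2\notin\lambda$, $z_{2a-2}\ge3$, $z_{2a-2}-2\notin\lambda$; (b) $(\lambda,(a))$ with $a\equiv2\pmod5$ and $a+1$ the only part of $\lambda$ that is $\le2a+2$. * $\mathcal I_5(n)$: $(\lambda,(a^2))$ with $a\equiv3\pmod5$ and either (a) $2a+3,2a+4\notin\lambda$, $z_{2a+2}\ge5$, $z_{2a+2}-t\notin\lambda$ for $t=2,3,4$; or (b) $3$ is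 the only part of $\lambda$ that is $\le2a+4$. * $\mathcal I_6(n)$: (a) $(\lambda,(a^4))$ with $a\equiv2\pmod5$, $a>2$, $4a+3,4a+4\notin\lambda$, $z_{4a+2}\ge5$, $z_{4a+2}-t\notin\lambda$ for $t=2,3,4$; (b) $(\lambda,(a^4))$ with $a\equiv2\pmod5$, $a>2$ and $3$ the only part of $\lambda$ that is $\le4a+4$; (c) $(\lambda,(3^3))$ with $10,11,12\notin\lambda$, $z_9\ge4$, $z_9-t\notin\lambda$ for $t=2,3$; (d) $(\lambda,(3^3))$ with $2$ the only part of $\lambda$ that is $\le12$. * $\mathcal I_7(n)$: (a) $(\lambda,(3^m))$ with $m\equiv7\pmod{20}$, $3m-3,3m-2,3m-1,3m,3m+1\notin\lambda$ and some part of $\lambda$ that is $\le3m-4$; (b) $(\lambda,(3^m))$ with $m\equiv0\pmod{20}$, $m>0$, $3m-1,3m,3m+1,3m+2\notin\lambda$, $z_{3m-2}\ge3$, $z_{3m-2}-2\notin\lambda$; (c) $(\lambda,(3^m))$ with $m\equiv13\pmod{20}$, $3m+1,3m+2,3m+3\notin\lambda$, $z_{3m}\ge4$, $z_{3m}-t\notin\lambda$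 for $t=2,3$; (d) $(\lambda,(3^m))$ with $m\equiv7\pmod{20}$ and no part of $\lambda$ that is $\le3m+1$; (e) $(\lambda,(3^m))$ with $m\equiv13\pmod{20}$ and $2$ the only part of $\lambda$ that is $\le3m+3$; (f) $(\lambda,(a))$ with $a\equiv13\pmod{15}$ and $a+1,a+3,a+5$ exactly the parts of $\lambda$ that are $\le4a+10$. Put $\mathcal S(n)=\mathcal S_1(n)\setminus\bigcup_{j=1}^7\mathcal I_j(n)$. **Theorem.** For every $n\ge0$, the set $\mathcal S(n)$ is finite, and the number of parts in all partitions of $n$ with parts congruent to $\pm2\pmod5$ minus the number of parts in all super-distinct partitions of $n$ with parts greater than $1$ equals $|\mathcal S(n)|$. Moreover, $\psi$ is an injection of $\mathcal S_2(n)$ into $\mathcal S_1(n)$; for each $j=1,\dots,7$ the image under $\psi$ of the elements of $\mathcal S_2(n)$ falling under case $j$ is $\mathcal I_j(n)$; and $\mathcal I_1(n),\dots,\mathcal I_7(n)$ are pairwise disjoint. -/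

import Mathlib

/-! Partitions are represented by the multiset of their parts. -/

namespace RRParts

/-- Any two parts of the partition differ by at least `2` (in particular no part is repeated),
and every part is greater than `1`. The empty partition is allowed. -/
def SuperDistinctGtOne (lam : Multiset ℕ) : Prop :=
  lam.Nodup ∧ (∀ p ∈ lam, ∀ q ∈ lam, p < q → p + 2 ≤ q) ∧ ∀ p ∈ lam, 1 < p

/-- The integer `a` is congruent to `2` or `-2` modulo `5`. -/
def CongPmTwo (a : ℕ) : Prop := a % 5 = 2 ∨ a % 5 = 3

open Classical in
/-- The number of parts (with multiplicity) in all partitions of `n` with parts congruent to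
`2` or `-2` modulo `5`. -/
noncomputable def numPartsCong (n : ℕ) : ℕ :=
  ∑ p : Nat.Partition n with ∀ i ∈ p.parts, CongPmTwo i, p.parts.card

open Classical in
/-- The number of parts in all super-distinct partitions of `n` with parts greater than `1`. -/
noncomputable def numPartsSuper (n : ℕ) : ℕ :=
  ∑ p : Nat.Partition n with SuperDistinctGtOne p.parts, p.parts.card

/-- A pair of partitions `(lam, (a ^ b))`, the second one consisting of `b` parts equal to `a`. -/
@[ext]
structure RectPair where
  lam : Multiset ℕ
  a : ℕ
  b : ℕ

/-- A partition `mu` with a marked part `c`. The partitions to which this is applied have distinct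
parts, so that the marked part is determined by its size. -/
@[ext]
structure Marked where
  mu : Multiset ℕ
  c : ℕ

/-- The pairs `(lam, (a ^ b))` of total size `n` such that `lam` is super-distinct with parts
greater than `1`, `a` is `2` or `-2` modulo `5`, and `b ≥ 1`. -/
def S1 (n : ℕ) : Set RectPair :=
  {t | SuperDistinctGtOne t.lam ∧ CongPmTwo t.a ∧ 1 ≤ t.b ∧ t.lam.sum + t.a * t.b = n}

/-- The marked super-distinct partitions of `n` with parts greater than `1`. -/
def S2 (n : ℕ) : Set Marked :=
  {M | SuperDistinctGtOne M.mu ∧ M.mu.sum = n ∧ M.c ∈ M.mu}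

/-- The part following the marked part `c`, i.e. the largest part below `c`;
it is `0` if `c` is the last part. -/
def Marked.x (M : Marked) : ℕ := (M.mu.filter (· < M.c)).sup

/-- The partition with the marked part removed. -/
def Marked.rest (M : Marked) : Multiset ℕ := M.mu.erase M.c

/-- The partition in which the marked part is removed and the following part `x` is replaced
by `x + d`. (Used only if there is a following part.) -/
def Marked.bump (M : Marked) (d : ℕ) : Multiset ℕ := (M.rest.erase M.x) + {M.x + d}

/-- The case, from `1` to `7`, of the definition of `psi` to which a marked partition belongs. -/
def Marked.case (M : Marked) : ℕ :=
  if M.c % 2 = 0 then 1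
  else if M.c % 5 = 2 ∨ M.c % 5 = 3 then 2
  else if M.c = M.x + 2 ∨ M.c = M.x + 3 then 3
  else if M.c % 5 = 0 then 4
  else if M.c % 5 = 4 then 5
  else if M.c % 20 = 11 then 6
  else 7

/-- The map `psi`, case by case. -/
def psi (M : Marked) : RectPair :=
  if M.case = 1 then
    -- `c = 2 k`
    ⟨M.rest, 2, M.c / 2⟩
  else if M.case = 2 then
    ⟨M.rest, M.c, 1⟩
  else if M.case = 3 then
    -- `c = 2 k + 1`
    ⟨M.bump 1, 2, M.c / 2⟩
  else if M.case = 4 then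
    -- `c = 10 j + 5`
    if M.x ≠ 0 then ⟨M.bump 1, 5 * (M.c / 10) + 2, 2⟩
    else ⟨M.rest + {5 * (M.c / 10) + 3}, 5 * (M.c / 10) + 2, 1⟩
  else if M.case = 5 then
    -- `c = 10 j + 9`
    if M.x ≠ 0 then ⟨M.bump 3, 5 * (M.c / 10) + 3, 2⟩
    else ⟨M.rest + {3}, 5 * (M.c / 10) + 3, 2⟩
  else if M.case = 6 then
    -- `c = 20 h + 11`, where `h > 0` or `h = 0`
    if 0 < M.c / 20 then
      if M.x ≠ 0 then ⟨M.bump 3, 5 * (M.c / 20) + 2, 4⟩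
      else ⟨M.rest + {3}, 5 * (M.c / 20) + 2, 4⟩
    else
      if M.x ≠ 0 then ⟨M.bump 2, 3, 3⟩
      else ⟨M.rest + {2}, 3, 3⟩
  else
    -- `c = 20 h + 1` with `h ≥ 1`, and `c = 3 m + r` with `0 ≤ r ≤ 2`
    if M.x ≠ 0 then ⟨M.bump (M.c % 3), 3, M.c / 3⟩
    else if M.c % 3 = 0 then ⟨M.rest, 3, M.c / 3⟩
    else if M.c % 3 = 2 then ⟨M.rest + {2}, 3, M.c / 3⟩
    else ⟨M.rest + {5 * (M.c / 20 - 1) + 8, 5 * (M.c / 20 - 1) + 6, 5 * (M.c / 20 - 1) + 4},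
      5 * (M.c / 20 - 1) + 3, 1⟩

/-- The largest part of `lam` that is at most `u`, and `0` if there is no such part. -/
def largestLE (lam : Multiset ℕ) (u : ℕ) : ℕ := (lam.filter (· ≤ u)).sup

def I1 (n : ℕ) : Set RectPair :=
  {t | t ∈ S1 n ∧ t.a = 2 ∧
    2 * t.b - 1 ∉ t.lam ∧ 2 * t.b ∉ t.lam ∧ 2 * t.b + 1 ∉ t.lam}

def I2 (n : ℕ) : Set RectPair :=
  {t | t ∈ S1 n ∧ t.b = 1 ∧ t.a % 2 = 1 ∧
    t.a - 1 ∉ t.lam ∧ t.a ∉ t.lam ∧ t.a + 1 ∉ t.lam}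

/-- The condition on `2 k + 1` (here `k = t.b`) restricts to the marked parts treated
in the third case. -/
def I3 (n : ℕ) : Set RectPair :=
  {t | t ∈ S1 n ∧ t.a = 2 ∧ 2 ≤ t.b ∧ ¬ CongPmTwo (2 * t.b + 1) ∧
      2 * t.b ∈ t.lam ∧ 2 * t.b - 2 ∉ t.lam ∧ 2 * t.b + 2 ∉ t.lam} ∪
  {t | t ∈ S1 n ∧ t.a = 2 ∧ 2 ≤ t.b ∧ ¬ CongPmTwo (2 * t.b + 1) ∧
      2 * t.b - 1 ∈ t.lam ∧ 2 * t.b - 3 ∉ t.lam ∧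
      2 * t.b + 1 ∉ t.lam ∧ 2 * t.b + 2 ∉ t.lam}

def I4 (n : ℕ) : Set RectPair :=
  {t | t ∈ S1 n ∧ t.b = 2 ∧ 2 < t.a ∧ t.a % 5 = 2 ∧
      2 * t.a - 1 ∉ t.lam ∧ 2 * t.a ∉ t.lam ∧ 2 * t.a + 1 ∉ t.lam ∧ 2 * t.a + 2 ∉ t.lam ∧
      3 ≤ largestLE t.lam (2 * t.a - 2) ∧ largestLE t.lam (2 * t.a - 2) - 2 ∉ t.lam} ∪
  {t | t ∈ S1 n ∧ t.b = 1 ∧ t.a % 5 = 2 ∧ t.a + 1 ∈ t.lam ∧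
      ∀ z, z ≤ 2 * t.a + 2 → z ≠ t.a + 1 → z ∉ t.lam}

def I5 (n : ℕ) : Set RectPair :=
  {t | t ∈ S1 n ∧ t.b = 2 ∧ t.a % 5 = 3 ∧
      2 * t.a + 3 ∉ t.lam ∧ 2 * t.a + 4 ∉ t.lam ∧
      5 ≤ largestLE t.lam (2 * t.a + 2) ∧
      largestLE t.lam (2 * t.a + 2) - 2 ∉ t.lam ∧
      largestLE t.lam (2 * t.a + 2) - 3 ∉ t.lam ∧
      largestLE t.lam (2 * t.a + 2) - 4 ∉ t.lam} ∪
  {t | t ∈ S1 n ∧ t.b = 2 ∧ t.a % 5 = 3 ∧ 3 ∈ t.lam ∧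
      ∀ z, z ≤ 2 * t.a + 4 → z ≠ 3 → z ∉ t.lam}

def I6 (n : ℕ) : Set RectPair :=
  {t | t ∈ S1 n ∧ t.b = 4 ∧ t.a % 5 = 2 ∧ 2 < t.a ∧
      4 * t.a + 3 ∉ t.lam ∧ 4 * t.a + 4 ∉ t.lam ∧
      5 ≤ largestLE t.lam (4 * t.a + 2) ∧
      largestLE t.lam (4 * t.a + 2) - 2 ∉ t.lam ∧
      largestLE t.lam (4 * t.a + 2) - 3 ∉ t.lam ∧
      largestLE t.lam (4 * t.a + 2) - 4 ∉ t.lam} ∪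
  {t | t ∈ S1 n ∧ t.b = 4 ∧ t.a % 5 = 2 ∧ 2 < t.a ∧ 3 ∈ t.lam ∧
      ∀ z, z ≤ 4 * t.a + 4 → z ≠ 3 → z ∉ t.lam} ∪
  {t | t ∈ S1 n ∧ t.a = 3 ∧ t.b = 3 ∧
      10 ∉ t.lam ∧ 11 ∉ t.lam ∧ 12 ∉ t.lam ∧
      4 ≤ largestLE t.lam 9 ∧ largestLE t.lam 9 - 2 ∉ t.lam ∧ largestLE t.lam 9 - 3 ∉ t.lam} ∪
  {t | t ∈ S1 n ∧ t.a = 3 ∧ t.b = 3 ∧ 2 ∈ t.lam ∧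
      ∀ z, z ≤ 12 → z ≠ 2 → z ∉ t.lam}

def I7 (n : ℕ) : Set RectPair :=
  {t | t ∈ S1 n ∧ t.a = 3 ∧ t.b % 20 = 7 ∧
      3 * t.b - 3 ∉ t.lam ∧ 3 * t.b - 2 ∉ t.lam ∧ 3 * t.b - 1 ∉ t.lam ∧
      3 * t.b ∉ t.lam ∧ 3 * t.b + 1 ∉ t.lam ∧
      ∃ z ∈ t.lam, z ≤ 3 * t.b - 4} ∪
  {t | t ∈ S1 n ∧ t.a = 3 ∧ t.b % 20 = 0 ∧ 0 < t.b ∧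
      3 * t.b - 1 ∉ t.lam ∧ 3 * t.b ∉ t.lam ∧
      3 * t.b + 1 ∉ t.lam ∧ 3 * t.b + 2 ∉ t.lam ∧
      3 ≤ largestLE t.lam (3 * t.b - 2) ∧ largestLE t.lam (3 * t.b - 2) - 2 ∉ t.lam} ∪
  {t | t ∈ S1 n ∧ t.a = 3 ∧ t.b % 20 = 13 ∧
      3 * t.b + 1 ∉ t.lam ∧ 3 * t.b + 2 ∉ t.lam ∧ 3 * t.b + 3 ∉ t.lam ∧
      4 ≤ largestLE t.lam (3 * t.b) ∧
      largestLE t.lam (3 * t.b) - 2 ∉ t.lam ∧ largestLE t.lam (3 * t.b) - 3 ∉ t.lam} ∪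
  {t | t ∈ S1 n ∧ t.a = 3 ∧ t.b % 20 = 7 ∧
      ∀ z, z ≤ 3 * t.b + 1 → z ∉ t.lam} ∪
  {t | t ∈ S1 n ∧ t.a = 3 ∧ t.b % 20 = 13 ∧ 2 ∈ t.lam ∧
      ∀ z, z ≤ 3 * t.b + 3 → z ≠ 2 → z ∉ t.lam} ∪
  {t | t ∈ S1 n ∧ t.b = 1 ∧ t.a % 15 = 13 ∧
      t.a + 1 ∈ t.lam ∧ t.a + 3 ∈ t.lam ∧ t.a + 5 ∈ t.lam ∧
      ∀ z, z ≤ 4 * t.a + 10 → z ≠ t.a + 1 → z ≠ t.a + 3 → z ≠ t.a + 5 → z ∉ t.lam}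

/-- The sets `I_1(n), …, I_7(n)` as a family (empty for other indices). -/
def I (j n : ℕ) : Set RectPair :=
  match j with
  | 1 => I1 n
  | 2 => I2 n
  | 3 => I3 n
  | 4 => I4 n
  | 5 => I5 n
  | 6 => I6 n
  | 7 => I7 n
  | _ => ∅

/-- The pairs in `S1 n` lying in none of the sets `I_1(n), …, I_7(n)`. -/
def S (n : ℕ) : Set RectPair := S1 n \ ⋃ j ∈ Finset.Icc 1 7, I j n

end RRParts

/-!
Counting parts amounts to counting objects with a distinguished part. A part of a partition into
parts `±2` modulo `5`, counted with multiplicity, is a value `a` with an index `b` between `1` and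
the multiplicity of `a`; removing `b` copies of `a` leaves a partition of `n - a b` of the same
kind. By the second Rogers–Ramanujan identity these are equinumerous with the super-distinct
partitions of `n - a b` with parts greater than `1`, so the first count is `|S1 n|`
(`numPartsCong_eq_ncard_S1`), while the second one is `|S2 n|` (`numPartsSuper_eq_ncard_S2`).
The difference is then the size of `S1 n` without the image of `psi`, once `psi` is known to be
injective with image the union of the sets `I j n`.

The Rogers–Ramanujan identity (`ncard_superFrom_two_eq_ncard_congFrom_zero`) is proved modulo
`X ^ (n + 1)`, in any commutative ring with a nilpotent element `x`, so that all sums and products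
are finite. The generating functions `C s` of super-distinct partitions with parts at least `s + 2`
satisfy `C s = C (s + 1) + x ^ (s + 2) C (s + 2)` and tend to `1`. The Rogers–Selberg series,
with terms `selbergTerm`, satisfy the same recurrence by telescoping (`selbergTerm_recurrence`)
and tend to the Euler product, so they are the multiples of `C s` by the Euler product. For `s = 0`
the series is a theta series, which the Jacobi triple product
(`sum_selbergTerm_zero_eq_prod`) turns into a product; the latter comes from a finite form with
Gaussian binomial coefficients (`sum_selbergTerm_mul_oddGauss`).

As for `psi`: in nearly all cases it deletes the marked part `c` and raises the following part `x`
by some `d`, where an absent `x` counts as `0` (`Marked.bump`). All other parts are at most `x - 2`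
or at least `c + 2` (`Marked.Valid.bump_cases`), so `x + d` is recognized as the largest part below
`c + 2`. Conversely, `c` can be restored whenever some part `x + d` has this isolated position
(`Marked.exists_bump_eq`). The conditions that define `I j n` say exactly this, and within one case
the rectangle determines `c`.
-/

namespace RRParts

/-! ### The sum side as a telescoping recurrence, and the finite triple product -/

section Algebra

variable {R : Type*} [CommRing R]

/-- The finite product `(1 - x) (1 - x ^ 2) ⋯ (1 - x ^ n)`. -/
def eulerProd (x : R) (n : ℕ) : R := ∏ k ∈ Finset.range n, (1 - x ^ (k + 1))

theorem eulerProd_succ (x : R) (n : ℕ) :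
    eulerProd x (n + 1) = eulerProd x n * (1 - x ^ (n + 1)) := Finset.prod_range_succ _ _

/-- The `n`-th term of the Rogers–Selberg series for super-distinct partitions with parts at least
`s + 2`, multiplied by `(1 - x) (1 - x ^ 2) ⋯`. The exponent is `n (5 n + 4 s + 3) / 2`. -/
def selbergTerm (x : R) (s n : ℕ) : R :=
  (-1) ^ n * x ^ (5 * n.choose 2 + (2 * s + 4) * n) * (1 - x ^ (2 * n + s + 1)) *
    ∏ k ∈ Finset.range s, (1 - x ^ (n + 1 + k))

/-- The telescoping certificate for the recurrence in `s` of the sums of `selbergTerm`. -/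
def selbergCert (x : R) (s n : ℕ) : R :=
  (-1) ^ n * x ^ (5 * n.choose 2 + (2 * s + 4) * n) * (1 + x ^ n - x ^ (2 * n + s + 1)) *
    ∏ k ∈ Finset.range (s + 1), (1 - x ^ (n + k))

theorem choose_succ_two (n : ℕ) : (n + 1).choose 2 = n.choose 2 + n := by
  rw [Nat.choose_succ_succ' n 1]; simp [add_comm]

theorem selbergTerm_recurrence (x : R) (s n : ℕ) :
    selbergTerm x (s + 1) n + x ^ (s + 2) * selbergTerm x (s + 2) n - selbergTerm x s n =
      selbergCert x s (n + 1) - selbergCert x s n := by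
  have h1 : ∏ k ∈ Finset.range (s + 1), (1 - x ^ (n + 1 + k)) =
      (∏ k ∈ Finset.range s, (1 - x ^ (n + 1 + k))) * (1 - x ^ (n + 1 + s)) :=
    Finset.prod_range_succ _ _
  have h2 : ∏ k ∈ Finset.range (s + 2), (1 - x ^ (n + 1 + k)) =
      (∏ k ∈ Finset.range s, (1 - x ^ (n + 1 + k))) * (1 - x ^ (n + 1 + s)) *
        (1 - x ^ (n + 1 + (s + 1))) := by
    rw [Finset.prod_range_succ, h1]
  have h3 : ∏ k ∈ Finset.range (s + 1), (1 - x ^ (n + k)) =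
      (∏ k ∈ Finset.range s, (1 - x ^ (n + 1 + k))) * (1 - x ^ n) := by
    rw [Finset.prod_range_succ']
    simp only [add_zero, add_comm, add_left_comm]
  simp only [selbergTerm, selbergCert, h1, h2, h3, choose_succ_two]
  ring

theorem selbergCert_zero (x : R) (s : ℕ) : selbergCert x s 0 = 0 := by
  simp [selbergCert, Finset.prod_range_succ']

theorem sum_selbergTerm_recurrence {x : R} {L : ℕ} (hx : x ^ L = 0) (s : ℕ) :
    ∑ n ∈ Finset.range L, selbergTerm x s n =
      ∑ n ∈ Finset.range L, selbergTerm x (s + 1) n +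
        x ^ (s + 2) * ∑ n ∈ Finset.range L, selbergTerm x (s + 2) n := by
  have h := Finset.sum_range_sub (selbergCert x s) L
  have h0 : selbergCert x s L = 0 := by
    have : x ^ (5 * L.choose 2 + (2 * s + 4) * L) = 0 :=
      pow_eq_zero_of_le (by nlinarith [Nat.zero_le (s * L)]) hx
    simp [selbergCert, this]
  simp only [← selbergTerm_recurrence, selbergCert_zero, h0, Finset.sum_sub_distrib,
    Finset.sum_add_distrib, ← Finset.mul_sum, sub_zero] at h
  linear_combination -h

/-- Once `x ^ L = 0`, the factors `1 - x ^ k` with `L ≤ k` are trivial. -/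
theorem eulerProd_eq_of_le {x : R} {L : ℕ} (hx : x ^ L = 0) {n : ℕ} (hn : L ≤ n + 1) :
    eulerProd x n = eulerProd x L := by
  have key : ∀ m, L ≤ m + 1 → eulerProd x (m + 1) = eulerProd x m := fun m hm => by
    rw [eulerProd_succ, pow_eq_zero_of_le hm hx, sub_zero, mul_one]
  have h2 : ∀ d, eulerProd x (n + d) = eulerProd x n := fun d => by
    induction d with
    | zero => rfl
    | succ d ih => rw [← add_assoc, key _ (by omega), ih]
  rcases Nat.lt_or_ge n L with h | h
  · obtain rfl : L = n + 1 := by omega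
    exact (key n le_rfl).symm
  · have h3 : ∀ d, eulerProd x (L + d) = eulerProd x L := fun d => by
      induction d with
      | zero => rfl
      | succ d ih => rw [← add_assoc, key _ (by omega), ih]
    obtain ⟨d, rfl⟩ := Nat.exists_eq_add_of_le h
    exact h3 d

theorem sum_selbergTerm_of_le {x : R} {L : ℕ} (hL : 0 < L) (hx : x ^ L = 0) {s : ℕ}
    (hs : L ≤ s + 2) :
    ∑ n ∈ Finset.range L, selbergTerm x s n = eulerProd x L := by
  obtain ⟨L, rfl⟩ : ∃ l, L = l + 1 := ⟨L - 1, by omega⟩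
  rw [Finset.sum_range_succ', Finset.sum_eq_zero, zero_add]
  · rw [← eulerProd_eq_of_le hx (n := s + 1) hs, eulerProd_succ]
    simp only [selbergTerm, eulerProd, zero_add, mul_zero, Nat.choose_zero_succ, pow_zero, one_mul,
      add_comm 1]
    ring
  · intro n _
    have : x ^ (5 * (n + 1).choose 2 + (2 * s + 4) * (n + 1)) = 0 :=
      pow_eq_zero_of_le (by nlinarith [Nat.zero_le (s * n)]) hx
    simp [selbergTerm, this]

/-- The recurrence of `sum_selbergTerm_recurrence`, together with the limiting value for large `s`,
determines a sequence. -/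
theorem eulerProd_mul_eq_sum_selbergTerm {x : R} {L : ℕ} (hL : 0 < L) (hx : x ^ L = 0)
    (C : ℕ → R) (hrec : ∀ s, C s = C (s + 1) + x ^ (s + 2) * C (s + 2))
    (hlim : ∀ s, L ≤ s + 2 → C s = 1) (s : ℕ) :
    eulerProd x L * C s = ∑ n ∈ Finset.range L, selbergTerm x s n := by
  have key : ∀ d s, L ≤ s + 2 + d →
      eulerProd x L * C s = ∑ n ∈ Finset.range L, selbergTerm x s n := by
    intro d
    induction d using Nat.strong_induction_on with
    | _ d ih =>
      intro s hs
      by_cases h : L ≤ s + 2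
      · rw [hlim s h, sum_selbergTerm_of_le hL hx h, mul_one]
      · rw [hrec s, sum_selbergTerm_recurrence hx, ← ih (d - 1) (by omega) (s + 1) (by omega),
          ← ih (d - 1) (by omega) (s + 2) (by omega)]
        ring
  exact key L s (by omega)

/-- The Gaussian binomial coefficient `[2 N + 1, N - j]` in base `p`, through the recurrence that
adding two factors to the finite triple product yields; it is `0` for `j > N`, which makes the
value of the truncated `N - j` irrelevant there. -/
def oddGauss (p : R) : ℕ → ℕ → R
  | 0, 0 => 1
  | 0, _ + 1 => 0
  | N + 1, 0 => (1 + p ^ (2 * N + 2)) * oddGauss p N 0 + p ^ (N + 1) * oddGauss p N 0 +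
      p ^ (N + 2) * oddGauss p N 1
  | N + 1, j + 1 => (1 + p ^ (2 * N + 2)) * oddGauss p N (j + 1) +
      p ^ (N - j) * oddGauss p N j + p ^ (N + j + 3) * oddGauss p N (j + 2)

theorem oddGauss_eq_zero (p : R) {N j : ℕ} (h : N < j) : oddGauss p N j = 0 := by
  induction N generalizing j with
  | zero => obtain ⟨j, rfl⟩ : ∃ i, j = i + 1 := ⟨j - 1, by omega⟩; rfl
  | succ N ih =>
    obtain ⟨j, rfl⟩ : ∃ i, j = i + 1 := ⟨j - 1, by omega⟩
    rw [oddGauss, ih (by omega), ih (by omega), ih (by omega)]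
    ring

/-- The quotient formula for `oddGauss`, free of division, with `N = j + d`. -/
theorem oddGauss_mul_eulerProd (p : R) (j d : ℕ) :
    oddGauss p (j + d) j * (eulerProd p d * eulerProd p (2 * j + d + 1)) =
      eulerProd p (2 * (j + d) + 1) := by
  obtain ⟨N, hN⟩ : ∃ N, N = j + d := ⟨_, rfl⟩
  induction N generalizing j d with
  | zero =>
    obtain ⟨rfl, rfl⟩ : j = 0 ∧ d = 0 := by omega
    simp [oddGauss, eulerProd]
  | succ N ih =>
    rw [← hN]
    rw [show 2 * (N + 1) + 1 = 2 * N + 1 + 1 + 1 by omega,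
      eulerProd_succ p (2 * N + 1 + 1), eulerProd_succ p (2 * N + 1)]
    -- the closed form for `N`, and its product with one more factor, where the index may pass the
    -- diagonal because both sides then vanish
    have self : ∀ i e, i + e = N →
        oddGauss p N i * (eulerProd p e * eulerProd p (N + i + 1)) = eulerProd p (2 * N + 1) := by
      intro i e h
      have := ih i e h.symm
      rwa [h, show 2 * i + e + 1 = N + i + 1 by omega] at this
    have next : ∀ i e, i + e = N + 1 →
        oddGauss p N i * (eulerProd p e * eulerProd p (N + i + 1)) =
          eulerProd p (2 * N + 1) * (1 - p ^ e) := by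
      intro i e h
      rcases e with _ | e
      · rw [oddGauss_eq_zero p (by omega)]; simp
      · rw [eulerProd_succ]
        linear_combination (1 - p ^ (e + 1)) * self i e (by omega)
    rcases j with _ | j
    · obtain rfl : d = N + 1 := by omega
      have s0 := self 0 N (by omega)
      have s1 := next 1 N (by omega)
      rw [oddGauss, show 2 * 0 + (N + 1) + 1 = N + 1 + 1 by omega]
      simp only [eulerProd_succ p N, eulerProd_succ p (N + 1), add_zero] at s0 s1 ⊢
      linear_combination ((1 + p ^ (2 * N + 2) + p ^ (N + 1)) * (1 - p ^ (N + 1)) *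
        (1 - p ^ (N + 1 + 1))) * s0 + p ^ (N + 2) * (1 - p ^ (N + 1)) * s1
    · obtain ⟨rfl⟩ : N = j + d := by omega
      have s0 := self j d rfl
      have s1 := next (j + 1) d (by omega)
      rw [oddGauss, show 2 * (j + 1) + d + 1 = (j + d) + j + 1 + 1 + 1 by omega,
        show j + d - j = d by omega]
      rcases d with _ | d
      · rw [oddGauss_eq_zero p (N := j + 0) (j := j + 2) (by omega)]
        rw [oddGauss_eq_zero p (N := j + 0) (j := j + 1) (by omega)]
        simp only [eulerProd_succ p (j + 0 + j + 1), eulerProd_succ p (j + 0 + j + 1 + 1)]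
        linear_combination (1 - p ^ (j + 0 + j + 1 + 1)) * (1 - p ^ (j + 0 + j + 1 + 1 + 1)) * s0
      · have s2 := next (j + 2) d (by omega)
        rw [← add_assoc (j + (d + 1))] at s1 s2
        simp only [eulerProd_succ p d, eulerProd_succ p (j + (d + 1) + j + 1),
          eulerProd_succ p (j + (d + 1) + j + 1 + 1)] at s0 s1 s2 ⊢
        linear_combination p ^ (d + 1) * (1 - p ^ (j + (d + 1) + j + 1 + 1)) *
          (1 - p ^ (j + (d + 1) + j + 1 + 1 + 1)) * s0 +
          (1 + p ^ (2 * (j + (d + 1)) + 2)) * (1 - p ^ (j + (d + 1) + j + 1 + 1 + 1)) * s1 +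
          p ^ (j + (d + 1) + j + 3) * (1 - p ^ (d + 1)) * s2

/-- The inductive step for the finite triple product. The term of index `j` times the two new
factors is a combination of the terms of index `j - 1`, `j` and `j + 1`, whence the recurrence of
`oddGauss`. -/
theorem sum_selbergTerm_mul_oddGauss_succ (x : R) (N : ℕ) :
    ∑ j ∈ Finset.range (N + 2), selbergTerm x 0 j * oddGauss (x ^ 5) (N + 1) j =
      (1 - x ^ (5 * N + 4)) * (1 - x ^ (5 * N + 6)) *
        ∑ j ∈ Finset.range (N + 1), selbergTerm x 0 j * oddGauss (x ^ 5) N j := by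
  -- the theta series extended to the index `-1`, where it repeats the value at `0`
  obtain ⟨e, he0, he⟩ : ∃ e : ℕ → R, e 0 = selbergTerm x 0 0 ∧ ∀ j, e (j + 1) = selbergTerm x 0 j :=
    ⟨fun j => Nat.casesOn j (selbergTerm x 0 0) (selbergTerm x 0), rfl, fun _ => rfl⟩
  set p := x ^ 5 with hp
  have hshift : ∀ j ∈ Finset.range (N + 1),
      p ^ (N - j) * selbergTerm x 0 (j + 1) + p ^ (N + 1 + j) * e j =
        -(x ^ (5 * N + 4) + x ^ (5 * N + 6)) * selbergTerm x 0 j := by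
    intro j hj
    obtain ⟨d, rfl⟩ := Nat.exists_eq_add_of_le (Nat.lt_succ_iff.1 (Finset.mem_range.1 hj))
    rw [Nat.add_sub_cancel_left]
    rcases j with _ | j
    · rw [he0]
      simp only [selbergTerm, hp, ← pow_mul, choose_succ_two, Finset.prod_range_zero,
        Nat.choose_zero_succ]
      ring
    · rw [he]
      simp only [selbergTerm, hp, ← pow_mul, choose_succ_two, Finset.prod_range_zero]
      ring
  have h1 : ∑ j ∈ Finset.range (N + 2), selbergTerm x 0 j * oddGauss p N j =
      ∑ j ∈ Finset.range (N + 1), selbergTerm x 0 j * oddGauss p N j := by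
    rw [Finset.sum_range_succ, oddGauss_eq_zero p (by omega), mul_zero, add_zero]
  have h2 : ∑ j ∈ Finset.range (N + 1), p ^ (N + 1 + j) * e j * oddGauss p N j =
      p ^ (N + 1) * selbergTerm x 0 0 * oddGauss p N 0 +
        ∑ j ∈ Finset.range (N + 2), p ^ (N + j + 2) * selbergTerm x 0 j * oddGauss p N (j + 1) := by
    rw [Finset.sum_range_succ', Finset.sum_range_succ _ (N + 1), Finset.sum_range_succ _ N,
      oddGauss_eq_zero p (j := N + 1) (by omega), oddGauss_eq_zero p (j := N + 1 + 1) (by omega),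
      he0, add_zero]
    simp only [he, mul_zero, add_zero]
    rw [add_comm]
    congr 1
    exact Finset.sum_congr rfl fun j _ => by ring
  have h3 : ∑ j ∈ Finset.range (N + 2), selbergTerm x 0 j * oddGauss p (N + 1) j =
      (1 + p ^ (2 * N + 2)) * ∑ j ∈ Finset.range (N + 2), selbergTerm x 0 j * oddGauss p N j +
      ∑ j ∈ Finset.range (N + 1), p ^ (N - j) * selbergTerm x 0 (j + 1) * oddGauss p N j +
      (p ^ (N + 1) * selbergTerm x 0 0 * oddGauss p N 0 +
        ∑ j ∈ Finset.range (N + 2),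
          p ^ (N + j + 2) * selbergTerm x 0 j * oddGauss p N (j + 1)) := by
    rw [Finset.sum_range_succ', Finset.sum_range_succ' _ (N + 1), Finset.sum_range_succ' _ (N + 1),
      mul_add, Finset.mul_sum]
    have : ∀ j, selbergTerm x 0 (j + 1) * oddGauss p (N + 1) (j + 1) =
        (1 + p ^ (2 * N + 2)) * (selbergTerm x 0 (j + 1) * oddGauss p N (j + 1)) +
        p ^ (N - j) * selbergTerm x 0 (j + 1) * oddGauss p N j +
        p ^ (N + (j + 1) + 2) * selbergTerm x 0 (j + 1) * oddGauss p N (j + 1 + 1) := by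
      intro j; rw [oddGauss]; ring
    simp only [this, Finset.sum_add_distrib]
    rw [oddGauss]
    ring
  rw [h3, ← h2, h1, add_assoc, ← Finset.sum_add_distrib]
  have h4 : ∑ j ∈ Finset.range (N + 1), (p ^ (N - j) * selbergTerm x 0 (j + 1) * oddGauss p N j +
      p ^ (N + 1 + j) * e j * oddGauss p N j) = -(x ^ (5 * N + 4) + x ^ (5 * N + 6)) *
        ∑ j ∈ Finset.range (N + 1), selbergTerm x 0 j * oddGauss p N j := by
    rw [Finset.mul_sum]
    exact Finset.sum_congr rfl fun j hj => by
      linear_combination oddGauss p N j * hshift j hj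
  rw [h4, hp]
  ring

/-- A finite form of the Jacobi triple product identity with base `x ^ 5` and argument `x`. -/
theorem sum_selbergTerm_mul_oddGauss (x : R) (N : ℕ) :
    ∑ j ∈ Finset.range (N + 1), selbergTerm x 0 j * oddGauss (x ^ 5) N j =
      (1 - x ^ (5 * N + 1)) *
        ∏ k ∈ Finset.range N, ((1 - x ^ (5 * k + 1)) * (1 - x ^ (5 * k + 4))) := by
  induction N with
  | zero => simp [selbergTerm, oddGauss]
  | succ N ih =>
    rw [sum_selbergTerm_mul_oddGauss_succ, ih, Finset.prod_range_succ]
    ring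

theorem eulerProd_five_mul (x : R) (N : ℕ) :
    eulerProd x (5 * N) = ∏ k ∈ Finset.range N, ((1 - x ^ (5 * k + 1)) * (1 - x ^ (5 * k + 2)) *
      (1 - x ^ (5 * k + 3)) * (1 - x ^ (5 * k + 4)) * (1 - x ^ (5 * k + 5))) := by
  induction N with
  | zero => rfl
  | succ N ih =>
    rw [Finset.prod_range_succ, ← ih, show 5 * (N + 1) = 5 * N + 1 + 1 + 1 + 1 + 1 by ring]
    simp only [eulerProd_succ]
    ring

theorem isUnit_one_sub_pow {x : R} {L : ℕ} (hx : x ^ L = 0) (k : ℕ) :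
    IsUnit (1 - x ^ (k + 1)) :=
  IsNilpotent.isUnit_one_sub
    ⟨L, by rw [← pow_mul]; exact pow_eq_zero_of_le (Nat.le_mul_of_pos_left _ (by omega)) hx⟩

theorem isUnit_eulerProd {x : R} {L : ℕ} (hx : x ^ L = 0) (n : ℕ) : IsUnit (eulerProd x n) :=
  Finset.prod_induction _ IsUnit (fun _ _ ha hb => ha.mul hb) isUnit_one fun k _ =>
    isUnit_one_sub_pow hx k

/-- The Jacobi triple product identity, truncated at order `L`. -/
theorem sum_selbergTerm_zero_eq_prod {x : R} {L : ℕ} (hL : 0 < L) (hx : x ^ L = 0) :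
    ∑ n ∈ Finset.range L, selbergTerm x 0 n =
      ∏ k ∈ Finset.range (2 * L),
        ((1 - x ^ (5 * k + 1)) * (1 - x ^ (5 * k + 4)) * (1 - x ^ (5 * k + 5))) := by
  have hp : (x ^ 5) ^ L = 0 := by
    rw [← pow_mul]; exact pow_eq_zero_of_le (by omega) hx
  have hunit := isUnit_eulerProd hp L
  -- all Gaussian binomials that matter are inverse to the Euler product
  have hg : ∀ j < L, oddGauss (x ^ 5) (2 * L) j * eulerProd (x ^ 5) L = 1 := by
    intro j hj
    have h := oddGauss_mul_eulerProd (x ^ 5) j (2 * L - j)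
    rw [Nat.add_sub_cancel' (by omega), eulerProd_eq_of_le hp (n := 2 * L - j) (by omega),
      eulerProd_eq_of_le hp (n := 2 * j + (2 * L - j) + 1) (by omega),
      eulerProd_eq_of_le hp (n := 2 * (2 * L) + 1) (by omega), ← mul_assoc] at h
    exact hunit.mul_right_cancel (by rw [h, one_mul])
  have h0 : ∀ j, L ≤ j → selbergTerm x 0 j = 0 := fun j hj => by
    have : x ^ (5 * j.choose 2 + (2 * 0 + 4) * j) = 0 := pow_eq_zero_of_le (by omega) hx
    simp [selbergTerm, this]
  have hsum := sum_selbergTerm_mul_oddGauss x (2 * L)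
  rw [pow_eq_zero_of_le (by omega : L ≤ 5 * (2 * L) + 1) hx, sub_zero, one_mul,
    ← Finset.sum_subset (Finset.range_subset_range.2 (by omega : L ≤ 2 * L + 1))
      (fun j _ hj => by rw [h0 j (by simpa using hj), zero_mul])] at hsum
  have hε : eulerProd (x ^ 5) L = ∏ k ∈ Finset.range (2 * L), (1 - x ^ (5 * k + 5)) := by
    rw [← eulerProd_eq_of_le hp (n := 2 * L) (by omega), eulerProd]
    exact Finset.prod_congr rfl fun k _ => by rw [← pow_mul]; rfl
  rw [Finset.prod_mul_distrib, ← hε, ← hsum, Finset.sum_mul]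
  exact Finset.sum_congr rfl fun j hj => by
    rw [mul_assoc, hg j (Finset.mem_range.1 hj), mul_one]

/-- The product side of the second Rogers–Ramanujan identity, truncated at order `L`. -/
theorem mul_prod_eq_one_of_recurrence {x : R} {L : ℕ} (hL : 0 < L) (hx : x ^ L = 0)
    (C : ℕ → R) (hrec : ∀ s, C s = C (s + 1) + x ^ (s + 2) * C (s + 2))
    (hlim : ∀ s, L ≤ s + 2 → C s = 1) :
    C 0 * ∏ k ∈ Finset.range (2 * L), ((1 - x ^ (5 * k + 2)) * (1 - x ^ (5 * k + 3))) = 1 := by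
  have h := eulerProd_mul_eq_sum_selbergTerm hL hx C hrec hlim 0
  rw [sum_selbergTerm_zero_eq_prod hL hx, ← eulerProd_eq_of_le hx (n := 5 * (2 * L)) (by omega),
    eulerProd_five_mul] at h
  have hunit : IsUnit (∏ k ∈ Finset.range (2 * L),
      ((1 - x ^ (5 * k + 1)) * (1 - x ^ (5 * k + 4)) * (1 - x ^ (5 * k + 5)))) :=
    Finset.prod_induction _ IsUnit (fun _ _ ha hb => ha.mul hb) isUnit_one fun k _ =>
      ((isUnit_one_sub_pow hx _).mul (isUnit_one_sub_pow hx _)).mul (isUnit_one_sub_pow hx _)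
  refine hunit.mul_right_cancel ?_
  rw [one_mul]
  refine Eq.trans ?_ h
  rw [mul_assoc, ← Finset.prod_mul_distrib, mul_comm]
  congr 1
  exact Finset.prod_congr rfl fun k _ => by ring

end Algebra

/-! ### The second Rogers–Ramanujan identity -/

section Counting

open PowerSeries

/-- The set of multisets with sum `n` that have the property `P`. -/
def withSum (P : Multiset ℕ → Prop) (n : ℕ) : Set (Multiset ℕ) := {l | P l ∧ l.sum = n}

theorem withSum_finite {P : Multiset ℕ → Prop} (hP : ∀ l, P l → 0 ∉ l) (n : ℕ) :
    (withSum P n).Finite := by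
  refine (Set.finite_range fun p : Nat.Partition n => p.parts).subset ?_
  rintro l ⟨hl, hs⟩
  exact ⟨⟨l, fun {i} hi => Nat.pos_of_ne_zero fun h => hP l hl (h ▸ hi), hs⟩, rfl⟩

/-- The generating function of the multisets with property `P`, by their sum. -/
noncomputable def genSeries (P : Multiset ℕ → Prop) : ℤ⟦X⟧ :=
  PowerSeries.mk fun n => ((withSum P n).ncard : ℤ)

/-- Removing a part `m`, when there is one, splits the generating function. -/
theorem genSeries_split {P : Multiset ℕ → Prop} (hP : ∀ l, P l → 0 ∉ l) (m : ℕ) :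
    genSeries P = genSeries (fun l => P l ∧ m ∉ l) + X ^ m * genSeries fun l => P (m ::ₘ l) := by
  ext n
  have hfin := withSum_finite hP n
  have hunion : withSum P n = withSum (fun l => P l ∧ m ∉ l) n ∪ {l ∈ withSum P n | m ∈ l} := by
    ext l; simp only [withSum, Set.mem_ofPred_eq, Set.mem_union]; tauto
  have hdisj : Disjoint (withSum (fun l => P l ∧ m ∉ l) n) {l ∈ withSum P n | m ∈ l} :=
    Set.disjoint_left.2 fun l h1 h2 => h1.1.2 h2.2
  have hcard := Set.ncard_union_eq hdisj (hfin.subset fun l h => ⟨h.1.1, h.2⟩)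
    (hfin.subset fun l h => h.1)
  rw [← hunion] at hcard
  rw [map_add, coeff_X_pow_mul']
  simp only [genSeries, coeff_mk]
  rw [hcard, Nat.cast_add]
  congr 1
  split_ifs with hmn
  · have : {l ∈ withSum P n | m ∈ l} =
        (fun l => m ::ₘ l) '' withSum (fun l => P (m ::ₘ l)) (n - m) := by
      ext l
      simp only [withSum, Set.mem_ofPred_eq, Set.mem_image]
      constructor
      · rintro ⟨⟨h1, h2⟩, h3⟩
        obtain ⟨t, rfl⟩ := Multiset.exists_cons_of_mem h3
        rw [Multiset.sum_cons] at h2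
        exact ⟨t, ⟨h1, by omega⟩, rfl⟩
      · rintro ⟨t, ⟨h1, h2⟩, rfl⟩
        exact ⟨⟨h1, by rw [Multiset.sum_cons]; omega⟩, Multiset.mem_cons_self m t⟩
    rw [this, Set.ncard_image_of_injective _ fun a b h => (Multiset.cons_inj_right m).1 h]
  · have : {l ∈ withSum P n | m ∈ l} = ∅ := by
      ext l
      simp only [withSum, Set.mem_ofPred_eq, Set.mem_empty_iff_false, iff_false]
      rintro ⟨⟨-, h2⟩, h3⟩
      exact hmn (h2 ▸ Multiset.le_sum_of_mem h3)
    simp [this]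

/-- If all parts are at least `m`, the empty multiset is the only one with sum below `m`. -/
theorem X_pow_dvd_genSeries_sub_one {P : Multiset ℕ → Prop} {m L : ℕ} (hL : L ≤ m)
    (h0 : P 0) (hP : ∀ l, P l → ∀ p ∈ l, m ≤ p) : (X : ℤ⟦X⟧) ^ L ∣ genSeries P - 1 := by
  rw [X_pow_dvd_iff]
  intro k hk
  rw [map_sub, coeff_one, genSeries, coeff_mk]
  have key : ∀ l, P l → l.sum = k → l = 0 := fun l hl hs =>
    Multiset.eq_zero_of_forall_notMem fun p hp => by
      have := Multiset.le_sum_of_mem hp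
      have := hP l hl p hp
      omega
  split_ifs with hk0
  · have : withSum P k = {0} := by
      ext l
      simp only [withSum, Set.mem_ofPred_eq, Set.mem_singleton_iff]
      exact ⟨fun h => key l h.1 h.2, fun h => by subst h; exact ⟨h0, by simp [hk0]⟩⟩
    simp [this]
  · have : withSum P k = ∅ := by
      ext l
      simp only [withSum, Set.mem_ofPred_eq, Set.mem_empty_iff_false, iff_false]
      rintro ⟨h1, h2⟩
      exact hk0 (by rw [← h2, key l h1 h2, Multiset.sum_zero])
    simp [this]

/-- Super-distinct partitions with parts at least `m`. -/
def SuperFrom (m : ℕ) (l : Multiset ℕ) : Prop :=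
  l.Nodup ∧ (∀ p ∈ l, ∀ q ∈ l, p < q → p + 2 ≤ q) ∧ ∀ p ∈ l, m ≤ p

/-- Partitions with parts congruent to `2` or `-2` modulo `5` and at least `m`. -/
def CongFrom (m : ℕ) (l : Multiset ℕ) : Prop := ∀ p ∈ l, CongPmTwo p ∧ m ≤ p

/-- Either `s + 2` is not a part, or removing it leaves parts that are at least `s + 4`. -/
theorem genSeries_superFrom (s : ℕ) :
    genSeries (SuperFrom (s + 2)) =
      genSeries (SuperFrom (s + 3)) + X ^ (s + 2) * genSeries (SuperFrom (s + 4)) := by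
  rw [genSeries_split (fun l hl h0 => absurd (hl.2.2 0 h0) (by omega)) (s + 2)]
  congr 3
  · funext l
    refine propext ⟨fun ⟨⟨h1, h2, h3⟩, h4⟩ => ⟨h1, h2, fun p hp => ?_⟩,
      fun ⟨h1, h2, h3⟩ => ⟨⟨h1, h2, fun p hp => ?_⟩, fun h => ?_⟩⟩
    · have := h3 p hp
      have : p ≠ s + 2 := fun h => h4 (h ▸ hp)
      omega
    · have := h3 p hp; omega
    · have := h3 _ h; omega
  · funext l
    simp only [SuperFrom, Multiset.nodup_cons, Multiset.forall_mem_cons]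
    refine propext ⟨fun ⟨⟨h1, h2⟩, ⟨⟨h3, h4⟩, h5⟩, h6, h7⟩ =>
      ⟨h2, fun p hp => (h5 p hp).2, fun p hp => ?_⟩, fun ⟨h1, h2, h3⟩ =>
      ⟨⟨fun h => ?_, h1⟩, ⟨⟨by omega, fun p hp _ => ?_⟩, fun p hp => ⟨fun h => ?_, h2 p hp⟩⟩,
        le_rfl, fun p hp => ?_⟩⟩
    · have := h7 p hp
      have : p ≠ s + 2 := fun h => h1 (h ▸ hp)
      have := h4 p hp (by omega)
      omega
    · have := h3 _ h; omega
    · have := h3 _ hp; omega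
    · have := h3 _ hp; omega
    · have := h3 _ hp; omega

theorem zero_notMem_of_congFrom {m : ℕ} {l : Multiset ℕ} (h : CongFrom m l) : 0 ∉ l :=
  fun h0 => by rcases (h 0 h0).1 with h | h <;> omega

theorem genSeries_congFrom_of_not {m : ℕ} (hm : ¬ CongPmTwo m) :
    genSeries (CongFrom m) = genSeries (CongFrom (m + 1)) := by
  congr 1
  funext l
  refine propext ⟨fun h p hp => ⟨(h p hp).1, ?_⟩, fun h p hp => ⟨(h p hp).1, ?_⟩⟩
  · have := (h p hp).2
    have : p ≠ m := fun e => hm (e ▸ (h p hp).1)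
    omega
  · have := (h p hp).2; omega

/-- Removing one part `m`, when there is one, leaves a partition of the same kind. -/
theorem genSeries_congFrom {m : ℕ} (hm : CongPmTwo m) :
    genSeries (CongFrom m) * (1 - X ^ m) = genSeries (CongFrom (m + 1)) := by
  have h := genSeries_split (fun l hl => zero_notMem_of_congFrom (m := m) hl) m
  have h1 : (fun l => CongFrom m l ∧ m ∉ l) = CongFrom (m + 1) := by
    funext l
    refine propext ⟨fun ⟨h, h'⟩ p hp => ⟨(h p hp).1, ?_⟩, fun h => ⟨fun p hp => ⟨(h p hp).1, ?_⟩,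
      fun h' => ?_⟩⟩
    · have := (h p hp).2
      have : p ≠ m := fun e => h' (e ▸ hp)
      omega
    · have := (h p hp).2; omega
    · have := (h _ h').2; omega
  have h2 : (fun l => CongFrom m (m ::ₘ l)) = CongFrom m := by
    funext l
    simp only [CongFrom, Multiset.forall_mem_cons]
    exact propext ⟨fun h => h.2, fun h => ⟨⟨hm, le_rfl⟩, h⟩⟩
  rw [h1, h2] at h
  linear_combination h

theorem genSeries_congFrom_mul_prod (M : ℕ) :
    genSeries (CongFrom 0) *
        ∏ k ∈ Finset.range M, ((1 - X ^ (5 * k + 2)) * (1 - X ^ (5 * k + 3))) =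
      genSeries (CongFrom (5 * M)) := by
  induction M with
  | zero => simp
  | succ M ih =>
    rw [Finset.prod_range_succ, ← mul_assoc, ih,
      genSeries_congFrom_of_not (m := 5 * M) (by unfold CongPmTwo; omega),
      genSeries_congFrom_of_not (m := 5 * M + 1) (by unfold CongPmTwo; omega), ← mul_assoc,
      genSeries_congFrom (m := 5 * M + 1 + 1) (Or.inl (by omega)),
      genSeries_congFrom (m := 5 * M + 2 + 1) (Or.inr (by omega)),
      genSeries_congFrom_of_not (m := 5 * M + 3 + 1) (by unfold CongPmTwo; omega)]
    rfl

/-- The second Rogers–Ramanujan identity. -/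
theorem ncard_superFrom_two_eq_ncard_congFrom_zero (n : ℕ) :
    (withSum (SuperFrom 2) n).ncard = (withSum (CongFrom 0) n).ncard := by
  -- it suffices to compare the generating functions modulo `X ^ (n + 1)`
  set π := Ideal.Quotient.mk (Ideal.span {(X : ℤ⟦X⟧) ^ (n + 1)}) with hπ
  have hx : π X ^ (n + 1) = 0 := by
    rw [← map_pow]; exact Ideal.Quotient.eq_zero_iff_mem.2 (Ideal.mem_span_singleton_self _)
  have hone : ∀ f : ℤ⟦X⟧, X ^ (n + 1) ∣ f - 1 → π f = 1 := fun f hf => by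
    rw [← map_one π]; exact Ideal.Quotient.eq.2 (Ideal.mem_span_singleton.2 hf)
  have h1 := mul_prod_eq_one_of_recurrence (Nat.succ_pos n) hx
    (fun s => π (genSeries (SuperFrom (s + 2))))
    (fun s => by
      rw [genSeries_superFrom s, map_add, map_mul, map_pow])
    (fun s hs => hone _ (X_pow_dvd_genSeries_sub_one hs
      ⟨by simp, by simp, by simp⟩ fun l hl => hl.2.2))
  have h2 := congrArg π (genSeries_congFrom_mul_prod (2 * (n + 1)))
  rw [hone _ (X_pow_dvd_genSeries_sub_one (by omega : n + 1 ≤ 5 * (2 * (n + 1)))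
    (fun p hp => absurd hp (Multiset.notMem_zero p)) fun l hl p hp => (hl p hp).2)] at h2
  simp only [map_mul, map_prod, map_sub, map_one, map_pow] at h2
  have hunit := IsUnit.of_mul_eq_one _ ((mul_comm _ _).trans h2)
  have h3 := hunit.mul_right_cancel (h1.trans h2.symm)
  have h4 := Ideal.mem_span_singleton.1 (Ideal.Quotient.eq.1 h3)
  have h5 := X_pow_dvd_iff.1 h4 n (Nat.lt_succ_self n)
  simpa [genSeries, sub_eq_zero] using h5

end Counting

/-! ### Counting parts by pairs and by marked partitions -/

section Pairs

/-- The pairs, of total size `n`, of a multiset with property `P` and a nonempty rectangular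
partition whose part size is `2` or `-2` modulo `5`. -/
def pairsWith (P : Multiset ℕ → Prop) (n : ℕ) : Set RectPair :=
  {t | P t.lam ∧ CongPmTwo t.a ∧ 1 ≤ t.b ∧ t.lam.sum + t.a * t.b = n}

open Classical in
theorem pairsWith_eq_image {P : Multiset ℕ → Prop} (hP : ∀ l, P l → 0 ∉ l) (n : ℕ) :
    pairsWith P n = (fun q : (_ : ℕ × ℕ) × Multiset ℕ => (⟨q.2, q.1.1, q.1.2⟩ : RectPair)) ''
      (((Finset.range (n + 1) ×ˢ Finset.range (n + 1)).filter fun q : ℕ × ℕ =>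
        CongPmTwo q.1 ∧ 1 ≤ q.2 ∧ q.1 * q.2 ≤ n).sigma fun q =>
          (withSum_finite hP (n - q.1 * q.2)).toFinset : Finset _) := by
  ext ⟨l, a, b⟩
  simp only [pairsWith, Set.mem_ofPred_eq, Set.mem_image, Finset.mem_coe, Finset.mem_sigma,
    Finset.mem_filter, Finset.mem_product, Finset.mem_range, Set.Finite.mem_toFinset, withSum,
    RectPair.mk.injEq]
  constructor
  · rintro ⟨h1, h2, h3, h4⟩
    have ha : 1 ≤ a := by rcases h2 with h | h <;> omega
    have := Nat.le_mul_of_pos_right a h3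
    have := Nat.le_mul_of_pos_left b ha
    exact ⟨⟨(a, b), l⟩,
      ⟨⟨⟨by dsimp only; omega, by dsimp only; omega⟩, h2, h3, by dsimp only; omega⟩,
      h1, by dsimp only; omega⟩, rfl, rfl, rfl⟩
  · rintro ⟨⟨⟨a, b⟩, l⟩, ⟨⟨-, h2, h3, h4⟩, h1, h5⟩, rfl, rfl, rfl⟩
    exact ⟨h1, h2, h3, by omega⟩

theorem pairsWith_finite {P : Multiset ℕ → Prop} (hP : ∀ l, P l → 0 ∉ l) (n : ℕ) :
    (pairsWith P n).Finite := by
  rw [pairsWith_eq_image hP]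
  exact (Finset.finite_toSet _).image _

open Classical in
theorem ncard_pairsWith {P : Multiset ℕ → Prop} (hP : ∀ l, P l → 0 ∉ l) (n : ℕ) :
    (pairsWith P n).ncard =
      ∑ q ∈ Finset.range (n + 1) ×ˢ Finset.range (n + 1) with
        CongPmTwo q.1 ∧ 1 ≤ q.2 ∧ q.1 * q.2 ≤ n, (withSum P (n - q.1 * q.2)).ncard := by
  rw [pairsWith_eq_image hP, Set.ncard_image_of_injective, Set.ncard_coe_finset, Finset.card_sigma]
  · exact Finset.sum_congr rfl fun q _ =>
      (Set.ncard_eq_toFinset_card _ (withSum_finite hP (n - q.1 * q.2))).symm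
  · rintro ⟨⟨a, b⟩, l⟩ ⟨⟨a', b'⟩, l'⟩ h
    simp only [RectPair.mk.injEq] at h
    obtain ⟨rfl, rfl, rfl⟩ := h
    rfl

/-- A part `a` of a partition, counted with multiplicity, amounts to a rectangle of `b` parts `a`
that can be removed from the partition. -/
theorem numPartsCong_eq_ncard (n : ℕ) : numPartsCong n = (pairsWith (CongFrom 0) n).ncard := by
  classical
  let T : Finset ((_ : Nat.Partition n) × (_ : ℕ) × ℕ) :=
    (Finset.univ.filter fun p : Nat.Partition n => ∀ i ∈ p.parts, CongPmTwo i).sigma fun p =>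
      p.parts.toFinset.sigma fun a => Finset.Icc 1 (p.parts.count a)
  have hT : T.card = numPartsCong n := by
    simp only [T, Finset.card_sigma, Nat.card_Icc, Nat.add_sub_cancel,
      Multiset.toFinset_sum_count_eq, numPartsCong]
  have hmem : ∀ p : Nat.Partition n, ∀ a b, (⟨p, a, b⟩ : (_ : Nat.Partition n) × (_ : ℕ) × ℕ) ∈ T ↔
      (∀ i ∈ p.parts, CongPmTwo i) ∧ 1 ≤ b ∧ Multiset.replicate b a ≤ p.parts := by
    intro p a b
    simp only [T, Finset.mem_sigma, Finset.mem_filter, Finset.mem_univ, true_and,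
      Multiset.mem_toFinset, Finset.mem_Icc, ← Multiset.le_count_iff_replicate_le]
    exact ⟨fun h => ⟨h.1, h.2.2⟩, fun h => ⟨h.1, Multiset.count_pos.1 (by omega), h.2⟩⟩
  rw [← hT, ← Set.ncard_coe_finset]
  refine Set.ncard_congr (fun q _ => ⟨q.1.parts - Multiset.replicate q.2.2 q.2.1, q.2.1, q.2.2⟩)
    ?_ ?_ ?_
  · rintro ⟨p, a, b⟩ h
    obtain ⟨h1, h2, h3⟩ := (hmem p a b).1 h
    have hs := congrArg Multiset.sum (Multiset.sub_add_cancel h3)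
    rw [Multiset.sum_add, Multiset.sum_replicate, p.parts_sum, smul_eq_mul, mul_comm b a] at hs
    exact ⟨fun i hi => ⟨h1 i (Multiset.mem_of_le (Multiset.sub_le_self _ _) hi), Nat.zero_le _⟩,
      h1 a (Multiset.mem_of_le h3 (Multiset.mem_replicate.2 ⟨by omega, rfl⟩)), h2, hs⟩
  · rintro ⟨p, a, b⟩ ⟨p', a', b'⟩ h h' heq
    simp only [RectPair.mk.injEq] at heq
    obtain ⟨h1, rfl, rfl⟩ := heq
    have := (Multiset.sub_add_cancel ((hmem _ _ _).1 h).2.2).symm.trans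
      (h1 ▸ Multiset.sub_add_cancel ((hmem _ _ _).1 h').2.2)
    rw [Nat.Partition.ext this]
  · rintro ⟨l, a, b⟩ ⟨h1, h2, h3, h4⟩
    dsimp only at h1 h2 h3 h4
    have hall : ∀ i ∈ l + Multiset.replicate b a, CongPmTwo i := fun i hi => by
      rcases Multiset.mem_add.1 hi with hi | hi
      · exact (h1 i hi).1
      · rwa [Multiset.eq_of_mem_replicate hi]
    refine ⟨⟨⟨l + Multiset.replicate b a, fun {i} hi => ?_, ?_⟩, a, b⟩, ?_, ?_⟩
    · rcases hall i hi with h | h <;> omega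
    · rw [Multiset.sum_add, Multiset.sum_replicate, smul_eq_mul, mul_comm b a, h4]
    · exact (hmem _ _ _).2 ⟨hall, h3, Multiset.le_add_left _ _⟩
    · simp

theorem S1_eq_pairsWith (n : ℕ) : S1 n = pairsWith (SuperFrom 2) n := rfl

theorem zero_notMem_of_superFrom_two {l : Multiset ℕ} (h : SuperFrom 2 l) : 0 ∉ l :=
  fun h0 => absurd (h.2.2 0 h0) (by omega)

theorem S1_finite (n : ℕ) : (S1 n).Finite :=
  pairsWith_finite (fun _ => zero_notMem_of_superFrom_two) n

theorem numPartsCong_eq_ncard_S1 (n : ℕ) : numPartsCong n = (S1 n).ncard := by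
  rw [numPartsCong_eq_ncard, S1_eq_pairsWith, ncard_pairsWith fun _ => zero_notMem_of_congFrom,
    ncard_pairsWith fun _ => zero_notMem_of_superFrom_two]
  simp only [ncard_superFrom_two_eq_ncard_congFrom_zero]

theorem numPartsSuper_eq_ncard_S2 (n : ℕ) : numPartsSuper n = (S2 n).ncard := by
  classical
  let T : Finset ((_ : Nat.Partition n) × ℕ) :=
    (Finset.univ.filter fun p : Nat.Partition n => SuperDistinctGtOne p.parts).sigma fun p =>
      p.parts.toFinset
  have hT : T.card = numPartsSuper n := by
    simp only [T, Finset.card_sigma, numPartsSuper]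
    refine Finset.sum_congr (by congr!) fun p hp => ?_
    exact Multiset.toFinset_card_of_nodup (Finset.mem_filter.1 hp).2.1
  rw [← hT, ← Set.ncard_coe_finset]
  refine Set.ncard_congr (fun q _ => ⟨q.1.parts, q.2⟩) ?_ ?_ ?_
  · rintro ⟨p, c⟩ h
    simp only [T, Finset.mem_coe, Finset.mem_sigma, Finset.mem_filter, Finset.mem_univ, true_and,
      Multiset.mem_toFinset] at h
    exact ⟨h.1, p.parts_sum, h.2⟩
  · rintro ⟨p, c⟩ ⟨p', c'⟩ _ _ heq
    simp only [Marked.mk.injEq] at heq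
    obtain ⟨h1, rfl⟩ := heq
    rw [Nat.Partition.ext h1]
  · rintro ⟨l, c⟩ ⟨h1, h2, h3⟩
    refine ⟨⟨⟨l, fun {i} hi => ?_, h2⟩, c⟩, ?_, rfl⟩
    · have := h1.2.2 i hi; omega
    · simp only [T, Finset.mem_coe, Finset.mem_sigma, Finset.mem_filter, Finset.mem_univ, true_and,
        Multiset.mem_toFinset]
      exact ⟨h1, h3⟩

end Pairs

/-! ### Super-distinct partitions with a marked part -/

section Marked

theorem sup_mem_of_ne_zero {s : Multiset ℕ} (h : s.sup ≠ 0) : s.sup ∈ s := by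
  induction s using Multiset.induction_on with
  | empty => simp at h
  | cons a s ih =>
    rw [Multiset.sup_cons] at h ⊢
    rcases le_total a s.sup with h' | h'
    · rw [sup_eq_right.2 h'] at h ⊢
      exact Multiset.mem_cons_of_mem (ih h)
    · rw [sup_eq_left.2 h']
      exact Multiset.mem_cons_self a s

theorem largestLE_mem {l : Multiset ℕ} {u : ℕ} (h : largestLE l u ≠ 0) :
    largestLE l u ∈ l ∧ largestLE l u ≤ u :=
  Multiset.mem_filter.1 (sup_mem_of_ne_zero h)

theorem le_largestLE {l : Multiset ℕ} {u z : ℕ} (hz : z ∈ l) (hu : z ≤ u) : z ≤ largestLE l u :=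
  Multiset.le_sup (Multiset.mem_filter.2 ⟨hz, hu⟩)

theorem largestLE_eq {l : Multiset ℕ} {u m : ℕ} (hm : m ∈ l) (hu : m ≤ u)
    (h : ∀ z ∈ l, z ≤ u → z ≤ m) : largestLE l u = m :=
  le_antisymm (Multiset.sup_le.2 fun z hz => h z (Multiset.mem_filter.1 hz).1
    (Multiset.mem_filter.1 hz).2) (le_largestLE hm hu)

theorem SuperDistinctGtOne.add_two_le {l : Multiset ℕ} (h : SuperDistinctGtOne l) {p q : ℕ}
    (hp : p ∈ l) (hq : q ∈ l) (hne : p ≠ q) : p + 2 ≤ q ∨ q + 2 ≤ p := by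
  rcases Nat.lt_or_gt_of_ne hne with h' | h'
  · exact Or.inl (h.2.1 p hp q hq h')
  · exact Or.inr (h.2.1 q hq p hp h')

theorem SuperDistinctGtOne.of_le {l l' : Multiset ℕ} (h : SuperDistinctGtOne l) (hl : l' ≤ l) :
    SuperDistinctGtOne l' :=
  ⟨Multiset.nodup_of_le hl h.1, fun p hp q hq => h.2.1 p (Multiset.mem_of_le hl hp) q
    (Multiset.mem_of_le hl hq), fun p hp => h.2.2 p (Multiset.mem_of_le hl hp)⟩

theorem SuperDistinctGtOne.add_singleton {l : Multiset ℕ} (h : SuperDistinctGtOne l) {m : ℕ}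
    (hm : 2 ≤ m) (hl : ∀ z ∈ l, z + 2 ≤ m ∨ m + 2 ≤ z) : SuperDistinctGtOne (l + {m}) := by
  rw [add_comm, Multiset.singleton_add]
  refine ⟨Multiset.nodup_cons.2 ⟨fun hmem => ?_, h.1⟩, fun p hp q hq hpq => ?_, fun p hp => ?_⟩
  · have := hl m hmem; omega
  · rcases Multiset.mem_cons.1 hp with hpm | hpl <;> rcases Multiset.mem_cons.1 hq with hqm | hql
    · omega
    · have := hl q hql; omega
    · have := hl p hpl; omega
    · exact h.2.1 p hpl q hql hpq
  · rcases Multiset.mem_cons.1 hp with rfl | hp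
    · omega
    · exact h.2.2 p hp

namespace Marked

variable {M : Marked}

/-- The marked partition is super-distinct with parts greater than `1`, and the mark is a part. -/
def Valid (M : Marked) : Prop := SuperDistinctGtOne M.mu ∧ M.c ∈ M.mu

theorem Valid.two_le (h : M.Valid) : 2 ≤ M.c := h.1.2.2 _ h.2

theorem x_eq {x : ℕ} (h0 : x ≠ 0 → x ∈ M.mu ∧ x < M.c) (h : ∀ z ∈ M.mu, z < M.c → z ≤ x) :
    M.x = x := by
  refine le_antisymm (Multiset.sup_le.2 fun z hz => h z (Multiset.mem_filter.1 hz).1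
    (Multiset.mem_filter.1 hz).2) ?_
  by_cases hx : x = 0
  · omega
  · exact Multiset.le_sup (Multiset.mem_filter.2 (h0 hx))

theorem x_mem (h : M.x ≠ 0) : M.x ∈ M.mu ∧ M.x < M.c :=
  Multiset.mem_filter.1 (sup_mem_of_ne_zero h)

theorem le_x {z : ℕ} (hz : z ∈ M.mu) (hc : z < M.c) : z ≤ M.x :=
  Multiset.le_sup (Multiset.mem_filter.2 ⟨hz, hc⟩)

theorem Valid.x_add_two_le (h : M.Valid) : M.x + 2 ≤ M.c := by
  by_cases hx : M.x = 0
  · have := h.two_le; omega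
  · exact h.1.2.1 _ (x_mem hx).1 _ h.2 (x_mem hx).2

theorem Valid.x_eq_zero_or (h : M.Valid) : M.x = 0 ∨ 2 ≤ M.x :=
  or_iff_not_imp_left.2 fun hx => h.1.2.2 _ (x_mem hx).1

/-- The position of a part relative to the marked part and the following one. -/
theorem Valid.cases (h : M.Valid) {z : ℕ} (hz : z ∈ M.mu) :
    z = M.c ∨ M.c + 2 ≤ z ∨ (z = M.x ∧ M.x ≠ 0) ∨ z + 2 ≤ M.x := by
  by_cases h1 : z = M.c
  · exact Or.inl h1
  rcases h.1.add_two_le hz h.2 h1 with h2 | h2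
  · have hle := le_x hz (by omega)
    have h2z := h.1.2.2 z hz
    by_cases h3 : z = M.x
    · omega
    · have := h.1.add_two_le hz (x_mem (by omega)).1 h3
      omega
  · omega

theorem Valid.mem_rest (h : M.Valid) {z : ℕ} : z ∈ M.rest ↔ z ∈ M.mu ∧ z ≠ M.c := by
  rw [Marked.rest, h.1.1.mem_erase_iff, and_comm]

theorem Valid.superDistinct_rest (h : M.Valid) : SuperDistinctGtOne M.rest :=
  h.1.of_le (Multiset.erase_le _ _)

theorem Valid.sum_rest (h : M.Valid) : M.rest.sum + M.c = M.mu.sum := by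
  rw [add_comm]; exact Multiset.sum_erase h.2

theorem Valid.mem_bump (h : M.Valid) {d z : ℕ} :
    z ∈ M.bump d ↔ (z ∈ M.mu ∧ z ≠ M.c ∧ z ≠ M.x) ∨ z = M.x + d := by
  rw [Marked.bump, Multiset.mem_add, h.superDistinct_rest.1.mem_erase_iff, h.mem_rest,
    Multiset.mem_singleton]
  tauto

/-- If no part follows the marked one, then `M.x = 0`, erasing `M.x` does nothing, and `M.bump d`
adjoins the part `d`. -/
theorem Valid.bump_of_x_eq_zero (h : M.Valid) (hx : M.x = 0) (d : ℕ) :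
    M.bump d = M.rest + {d} := by
  have h0 : 0 ∉ M.rest := fun h0 => absurd (h.superDistinct_rest.2.2 0 h0) (by omega)
  rw [Marked.bump, hx, Multiset.erase_of_notMem h0, zero_add]

theorem Valid.bump_zero (h : M.Valid) (hx : M.x ≠ 0) : M.bump 0 = M.rest := by
  have hmem : M.x ∈ M.rest := h.mem_rest.2 ⟨(x_mem hx).1, (x_mem hx).2.ne⟩
  rw [Marked.bump, add_zero, add_comm, Multiset.singleton_add, Multiset.cons_erase hmem]

theorem Valid.sum_bump (h : M.Valid) (d : ℕ) : (M.bump d).sum + M.c = M.mu.sum + d := by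
  have hs := h.sum_rest
  by_cases hx : M.x = 0
  · rw [h.bump_of_x_eq_zero hx, Multiset.sum_add, Multiset.sum_singleton]; omega
  · have hmem : M.x ∈ M.rest := h.mem_rest.2 ⟨(x_mem hx).1, (x_mem hx).2.ne⟩
    have := Multiset.sum_erase hmem
    rw [Marked.bump, Multiset.sum_add, Multiset.sum_singleton]
    omega

theorem Valid.bump_cases (h : M.Valid) {d z : ℕ} (hz : z ∈ M.bump d) :
    z = M.x + d ∨ M.c + 2 ≤ z ∨ z + 2 ≤ M.x := by
  rcases h.mem_bump.1 hz with ⟨h1, h2, h3⟩ | h1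
  · have := h.cases h1; omega
  · exact Or.inl h1

theorem Valid.x_add_mem_bump (h : M.Valid) (d : ℕ) : M.x + d ∈ M.bump d :=
  h.mem_bump.2 (Or.inr rfl)

theorem Valid.superDistinct_bump (h : M.Valid) {d : ℕ} (hd : M.x + d ≤ M.c) (h2 : 2 ≤ M.x + d) :
    SuperDistinctGtOne (M.bump d) := by
  refine (h.superDistinct_rest.of_le (Multiset.erase_le _ _)).add_singleton h2 fun z hz => ?_
  rw [h.superDistinct_rest.1.mem_erase_iff, h.mem_rest] at hz
  have := h.cases hz.2.1
  omega

theorem Valid.rest_cases (h : M.Valid) {z : ℕ} (hz : z ∈ M.rest) :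
    M.c + 2 ≤ z ∨ (z = M.x ∧ M.x ≠ 0) ∨ z + 2 ≤ M.x := by
  have h1 := h.mem_rest.1 hz
  have := h.cases h1.1
  omega

theorem Valid.eq_of_rest_eq {M' : Marked} (h : M.Valid) (h' : M'.Valid) (hc : M.c = M'.c)
    (hr : M.rest = M'.rest) : M = M' := by
  refine Marked.ext ?_ hc
  rw [← Multiset.cons_erase h.2, ← Multiset.cons_erase h'.2]
  exact congrArg₂ _ hc hr

theorem Valid.x_eq_of_bump_eq {M' : Marked} (h : M.Valid) (h' : M'.Valid) (hc : M.c = M'.c) {d : ℕ}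
    (hd : M.x + d ≤ M.c) (hd' : M'.x + d ≤ M'.c) (hr : M.bump d = M'.bump d) : M.x = M'.x := by
  have h1 := h'.bump_cases (hr ▸ h.x_add_mem_bump d)
  have h2 := h.bump_cases (hr ▸ h'.x_add_mem_bump d)
  omega

/-- Since `x + d` is the largest part of `M.bump d` below `c + 2`, the result of the bump and `c`
determine `x` and then the whole partition. -/
theorem Valid.eq_of_bump_eq {M' : Marked} (h : M.Valid) (h' : M'.Valid) (hc : M.c = M'.c) {d : ℕ}
    (hd : M.x + d ≤ M.c) (hd' : M'.x + d ≤ M'.c) (hr : M.bump d = M'.bump d) : M = M' := by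
  have hx := h.x_eq_of_bump_eq h' hc hd hd' hr
  refine h.eq_of_rest_eq h' hc ?_
  have hr' : M.rest.erase M.x = M'.rest.erase M'.x := by
    unfold Marked.bump at hr
    rw [hx] at hr ⊢
    exact add_right_cancel hr
  by_cases h0 : M.x = 0
  · have e := h.bump_of_x_eq_zero h0 d
    have e' := h'.bump_of_x_eq_zero (hx ▸ h0) d
    rw [e, e'] at hr
    exact add_right_cancel hr
  · rw [← h.bump_zero h0, ← h'.bump_zero (hx ▸ h0), Marked.bump, Marked.bump, hr', hx]

/-- Marking a new part `c` undoes the removal of the marked part. -/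
theorem exists_rest_eq {l : Multiset ℕ} (hl : SuperDistinctGtOne l) {c : ℕ} (hc : 2 ≤ c)
    (h : ∀ z ∈ l, z + 2 ≤ c ∨ c + 2 ≤ z) :
    ∃ M : Marked, M.Valid ∧ M.c = c ∧ M.rest = l ∧ M.mu.sum = l.sum + c := by
  refine ⟨⟨c ::ₘ l, c⟩, ⟨?_, Multiset.mem_cons_self _ _⟩, rfl, Multiset.erase_cons_head _ _, ?_⟩
  · dsimp only
    rw [← Multiset.singleton_add, add_comm]
    exact hl.add_singleton hc h
  · simp [add_comm]

/-- A part `x + d` of `l` is lowered to `x` (and omitted if `x = 0`), and a new marked part `c` is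
added, which undoes `Marked.bump`. -/
theorem exists_bump_eq {l : Multiset ℕ} (hl : SuperDistinctGtOne l) {c x d : ℕ}
    (hL : x + d ∈ l) (hx : x = 0 ∨ 2 ≤ x) (hxc : x + 2 ≤ c)
    (h : ∀ z ∈ l, z ≠ x + d → z + 2 ≤ x ∨ c + 2 ≤ z) :
    ∃ M : Marked, M.Valid ∧ M.c = c ∧ M.x = x ∧ M.bump d = l ∧ M.mu.sum + d = l.sum + c := by
  have herase : SuperDistinctGtOne (l.erase (x + d)) := hl.of_le (Multiset.erase_le _ _)
  have hmem : ∀ z ∈ l.erase (x + d), z + 2 ≤ x ∨ c + 2 ≤ z := fun z hz => by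
    rw [hl.1.mem_erase_iff] at hz
    exact h z hz.2 hz.1
  -- the partition without the marked part
  obtain ⟨r, hr, hrmem, hre⟩ : ∃ r, SuperDistinctGtOne r ∧ (∀ z ∈ r, z ≤ x ∨ c + 2 ≤ z) ∧
      r.erase x = l.erase (x + d) ∧ (x ≠ 0 → x ∈ r) := by
    rcases hx with rfl | hx
    · refine ⟨_, herase, fun z hz => ?_, Multiset.erase_of_notMem fun h0 => ?_, by simp⟩
      · have := hmem z hz; omega
      · exact absurd (herase.2.2 0 h0) (by omega)
    · refine ⟨_, herase.add_singleton hx fun z hz => ?_, fun z hz => ?_, ?_, fun _ => by simp⟩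
      · have := hmem z hz; omega
      · rcases Multiset.mem_add.1 hz with hz | hz
        · have := hmem z hz; omega
        · exact Or.inl (Multiset.mem_singleton.1 hz).le
      · rw [add_comm, Multiset.singleton_add, Multiset.erase_cons_head]
  obtain ⟨M, hM, rfl, rfl, hs⟩ := exists_rest_eq hr (c := c) (by omega) fun z hz => by
    have := hrmem z hz; omega
  have hxM : M.x = x := x_eq
    (fun h0 => ⟨(hM.mem_rest.1 (hre.2 h0)).1, by omega⟩) fun z hz hzc => by
      have := hrmem z (hM.mem_rest.2 ⟨hz, hzc.ne⟩); omega
  have hb : M.bump d = l := by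
    rw [Marked.bump, hxM, hre.1, add_comm, Multiset.singleton_add, Multiset.cons_erase hL]
  exact ⟨M, hM, rfl, hxM, hb, hb ▸ (hM.sum_bump d).symm⟩

end Marked

end Marked

/-! ### The images of the first six cases of `psi` -/

section Psi

namespace Marked

variable {M : Marked}

theorem mem_S2 {n : ℕ} : M ∈ S2 n ↔ M.Valid ∧ M.mu.sum = n := by
  simp only [S2, Valid, Set.mem_ofPred_eq]; tauto

theorem case_eq_one : M.case = 1 ↔ M.c % 2 = 0 := by
  unfold Marked.case; split_ifs <;> omega

theorem case_eq_two : M.case = 2 ↔ M.c % 2 = 1 ∧ (M.c % 5 = 2 ∨ M.c % 5 = 3) := by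
  unfold Marked.case; split_ifs <;> omega

theorem case_eq_three : M.case = 3 ↔
    M.c % 2 = 1 ∧ ¬ (M.c % 5 = 2 ∨ M.c % 5 = 3) ∧ (M.c = M.x + 2 ∨ M.c = M.x + 3) := by
  unfold Marked.case; split_ifs <;> omega

theorem case_eq_four : M.case = 4 ↔ M.c % 10 = 5 ∧ ¬ (M.c = M.x + 2 ∨ M.c = M.x + 3) := by
  unfold Marked.case; split_ifs <;> omega

theorem case_eq_five : M.case = 5 ↔ M.c % 10 = 9 ∧ ¬ (M.c = M.x + 2 ∨ M.c = M.x + 3) := by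
  unfold Marked.case; split_ifs <;> omega

theorem case_eq_six : M.case = 6 ↔ M.c % 20 = 11 ∧ ¬ (M.c = M.x + 2 ∨ M.c = M.x + 3) := by
  unfold Marked.case; split_ifs <;> omega

theorem case_eq_seven : M.case = 7 ↔ M.c % 20 = 1 ∧ ¬ (M.c = M.x + 2 ∨ M.c = M.x + 3) := by
  unfold Marked.case; split_ifs <;> omega

theorem case_mem_Icc (M : Marked) : M.case ∈ Finset.Icc 1 7 := by
  rw [Finset.mem_Icc]; unfold Marked.case; split_ifs <;> omega

theorem psi_of_case_one (h : M.case = 1) : psi M = ⟨M.rest, 2, M.c / 2⟩ := by simp [psi, h]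

theorem psi_of_case_two (h : M.case = 2) : psi M = ⟨M.rest, M.c, 1⟩ := by simp [psi, h]

theorem psi_of_case_three (h : M.case = 3) : psi M = ⟨M.bump 1, 2, M.c / 2⟩ := by simp [psi, h]

theorem psi_of_case_four (h : M.case = 4) (hx : M.x ≠ 0) :
    psi M = ⟨M.bump 1, 5 * (M.c / 10) + 2, 2⟩ := by simp [psi, h, hx]

theorem Valid.psi_of_case_four (hM : M.Valid) (h : M.case = 4) (hx : M.x = 0) :
    psi M = ⟨M.bump (5 * (M.c / 10) + 3), 5 * (M.c / 10) + 2, 1⟩ := by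
  simp [psi, h, hx, hM.bump_of_x_eq_zero hx]

theorem Valid.psi_of_case_five (hM : M.Valid) (h : M.case = 5) :
    psi M = ⟨M.bump 3, 5 * (M.c / 10) + 3, 2⟩ := by
  by_cases hx : M.x = 0
  · simp [psi, h, hx, hM.bump_of_x_eq_zero hx]
  · simp [psi, h, hx]

theorem Valid.psi_of_case_six (hM : M.Valid) (h : M.case = 6) (hc : 0 < M.c / 20) :
    psi M = ⟨M.bump 3, 5 * (M.c / 20) + 2, 4⟩ := by
  by_cases hx : M.x = 0
  · simp only [psi, h, hc, hx, hM.bump_of_x_eq_zero hx]; simp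
  · simp only [psi, h, hc]; simp [hx]

theorem Valid.psi_of_case_six' (hM : M.Valid) (h : M.case = 6) (hc : ¬ 0 < M.c / 20) :
    psi M = ⟨M.bump 2, 3, 3⟩ := by
  by_cases hx : M.x = 0
  · simp only [psi, h, hc, hx, hM.bump_of_x_eq_zero hx]; simp
  · simp only [psi, h, hc]; simp [hx]

theorem Valid.psi_of_case_seven_zero (hM : M.Valid) (h : M.case = 7) (hc : M.c % 3 = 0) :
    psi M = ⟨M.rest, 3, M.c / 3⟩ := by
  by_cases hx : M.x = 0
  · simp [psi, h, hc, hx]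
  · simp [psi, h, hc, hx, hM.bump_zero hx]

theorem psi_of_case_seven_one (h : M.case = 7) (hc : M.c % 3 = 1) (hx : M.x ≠ 0) :
    psi M = ⟨M.bump 1, 3, M.c / 3⟩ := by
  simp [psi, h, hc, hx]

theorem psi_of_case_seven_one' (h : M.case = 7) (hc : M.c % 3 = 1) (hx : M.x = 0) :
    psi M = ⟨M.rest + {5 * (M.c / 20 - 1) + 8, 5 * (M.c / 20 - 1) + 6, 5 * (M.c / 20 - 1) + 4},
      5 * (M.c / 20 - 1) + 3, 1⟩ := by
  simp [psi, h, hc, hx]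

theorem Valid.psi_of_case_seven_two (hM : M.Valid) (h : M.case = 7) (hc : M.c % 3 = 2) :
    psi M = ⟨M.bump 2, 3, M.c / 3⟩ := by
  by_cases hx : M.x = 0
  · simp [psi, h, hc, hx, hM.bump_of_x_eq_zero hx]
  · simp [psi, h, hc, hx]

theorem Valid.largestLE_bump (hM : M.Valid) {d u : ℕ} (hd : M.x + d ≤ u) (hu : u < M.c + 2) :
    largestLE (M.bump d) u = M.x + d :=
  largestLE_eq (hM.x_add_mem_bump d) hd fun z hz hzu => by
    have := hM.bump_cases hz; omega

theorem Valid.notMem_rest (hM : M.Valid) {z : ℕ} (h1 : z < M.c + 2) (h2 : M.x < z) :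
    z ∉ M.rest := fun hz => by have := hM.rest_cases hz; omega

theorem Valid.notMem_bump (hM : M.Valid) {d z : ℕ} (h1 : z < M.c + 2) (h2 : M.x < z + 2)
    (h3 : z ≠ M.x + d) : z ∉ M.bump d := fun hz => by have := hM.bump_cases hz; omega

end Marked

open Marked

/-- A part `x + d` of `l` that is the largest one up to `u`, with no parts in the `d + 1` places
below it and none between `u` and `c + 2`, can be lowered to `x` to make room for `c`. -/
theorem SuperDistinctGtOne.exists_bump_eq_of_largestLE {l : Multiset ℕ}
    (hl : SuperDistinctGtOne l) {c d u : ℕ} (h0 : d + 2 ≤ largestLE l u) (hu : u + 2 ≤ c + d)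
    (hgap : ∀ z ∈ l, u < z → c + 2 ≤ z)
    (hbelow : ∀ z ∈ l, z < largestLE l u → z + d + 2 ≤ largestLE l u) :
    ∃ M : Marked, M.Valid ∧ M.c = c ∧ M.x = largestLE l u - d ∧ M.bump d = l ∧
      M.mu.sum + d = l.sum + c := by
  have hL := largestLE_mem (l := l) (u := u) (by omega)
  refine exists_bump_eq hl (x := largestLE l u - d) ?_ (Or.inr (by omega)) (by omega) ?_
  · rw [Nat.sub_add_cancel (by omega)]; exact hL.1
  · intro z hz hne
    rw [Nat.sub_add_cancel (by omega)] at hne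
    by_cases hzu : z ≤ u
    · have := le_largestLE hz hzu
      have := hbelow z hz (by omega)
      omega
    · exact Or.inr (hgap z hz (by omega))

/-- The form of `Marked.exists_bump_eq` for `x = 0`: the only part `d` up to `c + 1` is omitted. -/
theorem SuperDistinctGtOne.exists_bump_eq_of_unique {l : Multiset ℕ}
    (hl : SuperDistinctGtOne l) {c d : ℕ} (hd : d ∈ l) (hc : 2 ≤ c)
    (h : ∀ z, z ≤ c + 1 → z ≠ d → z ∉ l) :
    ∃ M : Marked, M.Valid ∧ M.c = c ∧ M.x = 0 ∧ M.bump d = l ∧ M.mu.sum + d = l.sum + c := by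
  refine exists_bump_eq hl (by rwa [zero_add]) (Or.inl rfl) (by omega) fun z hz hne => ?_
  by_contra hcon
  exact h z (by omega) (by omega) hz

theorem image_case_one (n : ℕ) : psi '' {M | M ∈ S2 n ∧ M.case = 1} = I1 n := by
  ext t
  constructor
  · rintro ⟨M, ⟨hM, hcase⟩, rfl⟩
    obtain ⟨hM, hn⟩ := mem_S2.1 hM
    have hs := hM.sum_rest
    have hc := hM.two_le
    have hx := hM.x_add_two_le
    rw [psi_of_case_one hcase]
    have h2 := case_eq_one.1 hcase
    exact ⟨⟨hM.superDistinct_rest, Or.inl rfl, by dsimp only; omega, by dsimp only; omega⟩, rfl,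
      hM.notMem_rest (by dsimp only; omega) (by dsimp only; omega),
      hM.notMem_rest (by dsimp only; omega) (by dsimp only; omega),
      hM.notMem_rest (by dsimp only; omega) (by dsimp only; omega)⟩
  · obtain ⟨l, a, b⟩ := t
    rintro ⟨⟨hl, -, hb, hn⟩, ha, h1, h2, h3⟩
    dsimp only at *
    subst ha
    obtain ⟨M, hM, hc, hr, hs⟩ := exists_rest_eq hl (c := 2 * b) (by omega) fun z hz => by
      have := ne_of_mem_of_not_mem hz h1
      have := ne_of_mem_of_not_mem hz h2
      have := ne_of_mem_of_not_mem hz h3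
      omega
    have hcase : M.case = 1 := case_eq_one.2 (by omega)
    refine ⟨M, ⟨mem_S2.2 ⟨hM, by omega⟩, hcase⟩, ?_⟩
    rw [psi_of_case_one hcase, hr, hc, Nat.mul_div_cancel_left b (by omega)]

theorem image_case_two (n : ℕ) : psi '' {M | M ∈ S2 n ∧ M.case = 2} = I2 n := by
  ext t
  constructor
  · rintro ⟨M, ⟨hM, hcase⟩, rfl⟩
    obtain ⟨hM, hn⟩ := mem_S2.1 hM
    have hs := hM.sum_rest
    have hc := hM.two_le
    have hx := hM.x_add_two_le
    rw [psi_of_case_two hcase]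
    have h2 := case_eq_two.1 hcase
    exact ⟨⟨hM.superDistinct_rest, h2.2, le_rfl, by dsimp only; omega⟩, rfl, h2.1,
      hM.notMem_rest (by dsimp only; omega) (by dsimp only; omega),
      hM.notMem_rest (by dsimp only; omega) (by dsimp only; omega),
      hM.notMem_rest (by dsimp only; omega) (by dsimp only; omega)⟩
  · obtain ⟨l, a, b⟩ := t
    rintro ⟨⟨hl, ha, -, hn⟩, hb, ha2, h1, h2, h3⟩
    dsimp only at *
    subst hb
    have ha' : a % 5 = 2 ∨ a % 5 = 3 := ha
    obtain ⟨M, hM, hc, hr, hs⟩ := exists_rest_eq hl (c := a) (by omega) fun z hz => by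
      have := ne_of_mem_of_not_mem hz h1
      have := ne_of_mem_of_not_mem hz h2
      have := ne_of_mem_of_not_mem hz h3
      omega
    have hcase : M.case = 2 := case_eq_two.2 (by omega)
    refine ⟨M, ⟨mem_S2.2 ⟨hM, by omega⟩, hcase⟩, ?_⟩
    rw [psi_of_case_two hcase, hr, hc]

theorem image_case_three (n : ℕ) : psi '' {M | M ∈ S2 n ∧ M.case = 3} = I3 n := by
  ext t
  constructor
  · rintro ⟨M, ⟨hM, hcase⟩, rfl⟩
    obtain ⟨hM, hn⟩ := mem_S2.1 hM
    have hs := hM.sum_bump 1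
    have hc := hM.two_le
    have hx := hM.x_add_two_le
    have hx0 := hM.x_eq_zero_or
    rw [psi_of_case_three hcase]
    obtain ⟨h2, h5, hy⟩ := case_eq_three.1 hcase
    have hS1 : (⟨M.bump 1, 2, M.c / 2⟩ : RectPair) ∈ S1 n :=
      ⟨hM.superDistinct_bump (by omega) (by omega), Or.inl rfl, by dsimp only; omega,
        by dsimp only; omega⟩
    have hmem := hM.x_add_mem_bump 1
    rcases hy with hy | hy
    · refine Or.inl ⟨hS1, rfl, by dsimp only; omega, by unfold CongPmTwo; dsimp only; omega,
        ?_, hM.notMem_bump (by dsimp only; omega) (by dsimp only; omega) (by dsimp only; omega),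
        hM.notMem_bump (by dsimp only; omega) (by dsimp only; omega) (by dsimp only; omega)⟩
      dsimp only
      rwa [show 2 * (M.c / 2) = M.x + 1 by omega]
    · refine Or.inr ⟨hS1, rfl, by dsimp only; omega, by unfold CongPmTwo; dsimp only; omega,
        ?_, hM.notMem_bump (by dsimp only; omega) (by dsimp only; omega) (by dsimp only; omega),
        hM.notMem_bump (by dsimp only; omega) (by dsimp only; omega) (by dsimp only; omega),
        hM.notMem_bump (by dsimp only; omega) (by dsimp only; omega) (by dsimp only; omega)⟩
      dsimp only
      rwa [show 2 * (M.c / 2) - 1 = M.x + 1 by omega]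
  · obtain ⟨l, a, b⟩ := t
    -- in both forms a part `x + 1` just below `2 b + 1` is lowered to `x`
    have key : ∀ x, SuperDistinctGtOne l → 2 ≤ b → l.sum + 2 * b = n →
        ¬ CongPmTwo (2 * b + 1) → x + 1 ∈ l → (2 * b + 1 = x + 2 ∨ 2 * b + 1 = x + 3) →
        (∀ z ∈ l, z ≠ x + 1 → z + 2 ≤ x ∨ 2 * b + 1 + 2 ≤ z) →
        ∃ M, (M ∈ S2 n ∧ M.case = 3) ∧ psi M = ⟨l, 2, b⟩ := by
      intro x hl hb hn h5 hx hy hz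
      obtain ⟨M, hM, hc, hMx, hr, hs⟩ := exists_bump_eq hl (c := 2 * b + 1) hx (by omega)
        (by omega) hz
      have hcase : M.case = 3 := case_eq_three.2 ⟨by omega, by rw [hc]; exact h5, by omega⟩
      refine ⟨M, ⟨mem_S2.2 ⟨hM, by omega⟩, hcase⟩, ?_⟩
      rw [psi_of_case_three hcase, hr, show M.c / 2 = b by omega]
    rintro (⟨⟨hl, -, hb, hn⟩, ha, hb2, h5, h0, h1, h2⟩ |
      ⟨⟨hl, -, hb, hn⟩, ha, hb2, h5, h0, h1, h2, h3⟩)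
    · dsimp only at *
      subst ha
      refine key (2 * b - 1) hl hb2 hn h5 (by rwa [show 2 * b - 1 + 1 = 2 * b by omega]) (by omega)
        fun z hz hne => ?_
      have := ne_of_mem_of_not_mem hz h1
      have := ne_of_mem_of_not_mem hz h2
      have := hl.add_two_le hz h0 (by omega)
      omega
    · dsimp only at *
      subst ha
      refine key (2 * b - 2) hl hb2 hn h5 (by rwa [show 2 * b - 2 + 1 = 2 * b - 1 by omega])
        (by omega) fun z hz hne => ?_
      have := ne_of_mem_of_not_mem hz h1
      have := ne_of_mem_of_not_mem hz h2
      have := ne_of_mem_of_not_mem hz h3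
      have := hl.add_two_le hz h0 (by omega)
      omega

theorem image_case_four (n : ℕ) : psi '' {M | M ∈ S2 n ∧ M.case = 4} = I4 n := by
  ext t
  constructor
  · rintro ⟨M, ⟨hM, hcase⟩, rfl⟩
    obtain ⟨hM, hn⟩ := mem_S2.1 hM
    have hx := hM.x_add_two_le
    have hx0 := hM.x_eq_zero_or
    obtain ⟨h5, hy⟩ := case_eq_four.1 hcase
    by_cases h0 : M.x = 0
    · have hs := hM.sum_bump (5 * (M.c / 10) + 3)
      have hmem := hM.x_add_mem_bump (5 * (M.c / 10) + 3)
      rw [hM.psi_of_case_four hcase h0]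
      refine Or.inr ⟨⟨hM.superDistinct_bump (by omega) (by omega), Or.inl (by dsimp only; omega),
        le_rfl, by dsimp only; omega⟩, rfl, by dsimp only; omega, ?_, fun z hz hne => ?_⟩
      · rwa [h0, zero_add] at hmem
      · dsimp only at hz hne
        exact hM.notMem_bump (by omega) (by omega) (by omega)
    · have hs := hM.sum_bump 1
      rw [psi_of_case_four hcase h0]
      refine Or.inl ⟨⟨hM.superDistinct_bump (by omega) (by omega), Or.inl (by dsimp only; omega),
        by dsimp only; omega, by dsimp only; omega⟩, rfl, by dsimp only; omega,
        by dsimp only; omega,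
        hM.notMem_bump (by dsimp only; omega) (by dsimp only; omega) (by dsimp only; omega),
        hM.notMem_bump (by dsimp only; omega) (by dsimp only; omega) (by dsimp only; omega),
        hM.notMem_bump (by dsimp only; omega) (by dsimp only; omega) (by dsimp only; omega),
        hM.notMem_bump (by dsimp only; omega) (by dsimp only; omega) (by dsimp only; omega), ?_⟩
      dsimp only
      rw [hM.largestLE_bump (by omega) (by omega)]
      exact ⟨by omega, hM.notMem_bump (by omega) (by omega) (by omega)⟩
  · obtain ⟨l, a, b⟩ := t
    rintro (⟨⟨hl, -, -, hn⟩, hb, ha, h5, h1, h2, h3, h4, hL, hL2⟩ | ⟨⟨hl, -, -, hn⟩, hb, h5, hd, h⟩)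
    · dsimp only at *
      subst hb
      have hLm := largestLE_mem (l := l) (u := 2 * a - 2) (by omega)
      obtain ⟨M, hM, hc, hMx, hr, hs⟩ := hl.exists_bump_eq_of_largestLE (c := 2 * a + 1) (d := 1)
        hL (by omega)
        (fun z hz hu => by
          have := ne_of_mem_of_not_mem hz h1
          have := ne_of_mem_of_not_mem hz h2
          have := ne_of_mem_of_not_mem hz h3
          have := ne_of_mem_of_not_mem hz h4
          omega)
        (fun z hz hu => by
          have := ne_of_mem_of_not_mem hz hL2
          have := hl.2.1 _ hz _ hLm.1 hu
          omega)
      have hcase : M.case = 4 := case_eq_four.2 (by omega)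
      refine ⟨M, ⟨mem_S2.2 ⟨hM, by omega⟩, hcase⟩, ?_⟩
      rw [psi_of_case_four hcase (by omega), hr, show 5 * (M.c / 10) + 2 = a by omega]
    · dsimp only at *
      subst hb
      obtain ⟨M, hM, hc, hMx, hr, hs⟩ :=
        hl.exists_bump_eq_of_unique (c := 2 * a + 1) hd (by omega) h
      have hcase : M.case = 4 := case_eq_four.2 (by omega)
      refine ⟨M, ⟨mem_S2.2 ⟨hM, by omega⟩, hcase⟩, ?_⟩
      rw [hM.psi_of_case_four hcase hMx, show 5 * (M.c / 10) + 3 = a + 1 by omega, hr,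
        show 5 * (M.c / 10) + 2 = a by omega]

theorem image_case_five (n : ℕ) : psi '' {M | M ∈ S2 n ∧ M.case = 5} = I5 n := by
  ext t
  constructor
  · rintro ⟨M, ⟨hM, hcase⟩, rfl⟩
    obtain ⟨hM, hn⟩ := mem_S2.1 hM
    have hx := hM.x_add_two_le
    have hx0 := hM.x_eq_zero_or
    obtain ⟨h5, hy⟩ := case_eq_five.1 hcase
    have hs := hM.sum_bump 3
    have hmem := hM.x_add_mem_bump 3
    rw [hM.psi_of_case_five hcase]
    have hS1 : (⟨M.bump 3, 5 * (M.c / 10) + 3, 2⟩ : RectPair) ∈ S1 n :=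
      ⟨hM.superDistinct_bump (by omega) (by omega), Or.inr (by dsimp only; omega),
        by dsimp only; omega, by dsimp only; omega⟩
    by_cases h0 : M.x = 0
    · refine Or.inr ⟨hS1, rfl, by dsimp only; omega, ?_, fun z hz hne => ?_⟩
      · rwa [h0, zero_add] at hmem
      · dsimp only at hz hne
        exact hM.notMem_bump (by omega) (by omega) (by omega)
    · refine Or.inl ⟨hS1, rfl, by dsimp only; omega,
        hM.notMem_bump (by dsimp only; omega) (by dsimp only; omega) (by dsimp only; omega),
        hM.notMem_bump (by dsimp only; omega) (by dsimp only; omega) (by dsimp only; omega), ?_⟩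
      dsimp only
      rw [hM.largestLE_bump (by omega) (by omega)]
      exact ⟨by omega, hM.notMem_bump (by omega) (by omega) (by omega),
        hM.notMem_bump (by omega) (by omega) (by omega),
        hM.notMem_bump (by omega) (by omega) (by omega)⟩
  · obtain ⟨l, a, b⟩ := t
    rintro (⟨⟨hl, -, -, hn⟩, hb, h5, h1, h2, hL, hL2, hL3, hL4⟩ | ⟨⟨hl, -, -, hn⟩, hb, h5, hd, h⟩)
    · dsimp only at *
      subst hb
      have hLm := largestLE_mem (l := l) (u := 2 * a + 2) (by omega)
      obtain ⟨M, hM, hc, hMx, hr, hs⟩ := hl.exists_bump_eq_of_largestLE (c := 2 * a + 3) (d := 3)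
        hL (by omega)
        (fun z hz hu => by
          have := ne_of_mem_of_not_mem hz h1
          have := ne_of_mem_of_not_mem hz h2
          omega)
        (fun z hz hu => by
          have := ne_of_mem_of_not_mem hz hL2
          have := ne_of_mem_of_not_mem hz hL3
          have := ne_of_mem_of_not_mem hz hL4
          have := hl.2.1 _ hz _ hLm.1 hu
          omega)
      have hcase : M.case = 5 := case_eq_five.2 (by omega)
      refine ⟨M, ⟨mem_S2.2 ⟨hM, by omega⟩, hcase⟩, ?_⟩
      rw [hM.psi_of_case_five hcase, hr, show 5 * (M.c / 10) + 3 = a by omega]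
    · dsimp only at *
      subst hb
      obtain ⟨M, hM, hc, hMx, hr, hs⟩ :=
        hl.exists_bump_eq_of_unique (c := 2 * a + 3) hd (by omega) h
      have hcase : M.case = 5 := case_eq_five.2 (by omega)
      refine ⟨M, ⟨mem_S2.2 ⟨hM, by omega⟩, hcase⟩, ?_⟩
      rw [hM.psi_of_case_five hcase, hr, show 5 * (M.c / 10) + 3 = a by omega]

theorem image_case_six (n : ℕ) : psi '' {M | M ∈ S2 n ∧ M.case = 6} = I6 n := by
  ext t
  constructor
  · rintro ⟨M, ⟨hM, hcase⟩, rfl⟩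
    obtain ⟨hM, hn⟩ := mem_S2.1 hM
    have hx := hM.x_add_two_le
    have hx0 := hM.x_eq_zero_or
    obtain ⟨h5, hy⟩ := case_eq_six.1 hcase
    by_cases hh : 0 < M.c / 20
    · have hs := hM.sum_bump 3
      have hmem := hM.x_add_mem_bump 3
      rw [hM.psi_of_case_six hcase hh]
      have hS1 : (⟨M.bump 3, 5 * (M.c / 20) + 2, 4⟩ : RectPair) ∈ S1 n :=
        ⟨hM.superDistinct_bump (by omega) (by omega), Or.inl (by dsimp only; omega),
          by dsimp only; omega, by dsimp only; omega⟩
      by_cases h0 : M.x = 0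
      · refine Or.inl (Or.inl (Or.inr ⟨hS1, rfl, by dsimp only; omega, by dsimp only; omega, ?_,
          fun z hz hne => ?_⟩))
        · rwa [h0, zero_add] at hmem
        · dsimp only at hz hne
          exact hM.notMem_bump (by omega) (by omega) (by omega)
      · refine Or.inl (Or.inl (Or.inl ⟨hS1, rfl, by dsimp only; omega, by dsimp only; omega,
          hM.notMem_bump (by dsimp only; omega) (by dsimp only; omega) (by dsimp only; omega),
          hM.notMem_bump (by dsimp only; omega) (by dsimp only; omega) (by dsimp only; omega), ?_⟩))
        dsimp only
        rw [hM.largestLE_bump (by omega) (by omega)]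
        exact ⟨by omega, hM.notMem_bump (by omega) (by omega) (by omega),
          hM.notMem_bump (by omega) (by omega) (by omega),
          hM.notMem_bump (by omega) (by omega) (by omega)⟩
    · have hs := hM.sum_bump 2
      have hmem := hM.x_add_mem_bump 2
      rw [hM.psi_of_case_six' hcase hh]
      have hS1 : (⟨M.bump 2, 3, 3⟩ : RectPair) ∈ S1 n :=
        ⟨hM.superDistinct_bump (by omega) (by omega), Or.inr rfl,
          by dsimp only; omega, by dsimp only; omega⟩
      by_cases h0 : M.x = 0
      · refine Or.inr ⟨hS1, rfl, rfl, ?_, fun z hz hne => ?_⟩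
        · rwa [h0, zero_add] at hmem
        · exact hM.notMem_bump (by omega) (by omega) (by omega)
      · refine Or.inl (Or.inr ⟨hS1, rfl, rfl, hM.notMem_bump (by omega) (by omega) (by omega),
          hM.notMem_bump (by omega) (by omega) (by omega),
          hM.notMem_bump (by omega) (by omega) (by omega), ?_⟩)
        dsimp only
        rw [hM.largestLE_bump (by omega) (by omega)]
        exact ⟨by omega, hM.notMem_bump (by omega) (by omega) (by omega),
          hM.notMem_bump (by omega) (by omega) (by omega)⟩
  · obtain ⟨l, a, b⟩ := t
    rintro (((⟨⟨hl, -, -, hn⟩, hb, h5, ha, h1, h2, hL, hL2, hL3, hL4⟩ |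
      ⟨⟨hl, -, -, hn⟩, hb, h5, ha, hd, h⟩) |
      ⟨⟨hl, -, -, hn⟩, ha, hb, h1, h2, h3, hL, hL2, hL3⟩) | ⟨⟨hl, -, -, hn⟩, ha, hb, hd, h⟩)
    · dsimp only at *
      subst hb
      have hLm := largestLE_mem (l := l) (u := 4 * a + 2) (by omega)
      obtain ⟨M, hM, hc, hMx, hr, hs⟩ := hl.exists_bump_eq_of_largestLE (c := 4 * a + 3) (d := 3)
        hL (by omega)
        (fun z hz hu => by
          have := ne_of_mem_of_not_mem hz h1
          have := ne_of_mem_of_not_mem hz h2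
          omega)
        (fun z hz hu => by
          have := ne_of_mem_of_not_mem hz hL2
          have := ne_of_mem_of_not_mem hz hL3
          have := ne_of_mem_of_not_mem hz hL4
          have := hl.2.1 _ hz _ hLm.1 hu
          omega)
      have hcase : M.case = 6 := case_eq_six.2 (by omega)
      refine ⟨M, ⟨mem_S2.2 ⟨hM, by omega⟩, hcase⟩, ?_⟩
      rw [hM.psi_of_case_six hcase (by omega), hr, show 5 * (M.c / 20) + 2 = a by omega]
    · dsimp only at *
      subst hb
      obtain ⟨M, hM, hc, hMx, hr, hs⟩ :=
        hl.exists_bump_eq_of_unique (c := 4 * a + 3) hd (by omega) h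
      have hcase : M.case = 6 := case_eq_six.2 (by omega)
      refine ⟨M, ⟨mem_S2.2 ⟨hM, by omega⟩, hcase⟩, ?_⟩
      rw [hM.psi_of_case_six hcase (by omega), hr, show 5 * (M.c / 20) + 2 = a by omega]
    · dsimp only at *
      subst ha hb
      have hLm := largestLE_mem (l := l) (u := 9) (by omega)
      obtain ⟨M, hM, hc, hMx, hr, hs⟩ := hl.exists_bump_eq_of_largestLE (c := 11) (d := 2)
        hL (by omega)
        (fun z hz hu => by
          have := ne_of_mem_of_not_mem hz h1
          have := ne_of_mem_of_not_mem hz h2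
          have := ne_of_mem_of_not_mem hz h3
          omega)
        (fun z hz hu => by
          have := ne_of_mem_of_not_mem hz hL2
          have := ne_of_mem_of_not_mem hz hL3
          have := hl.2.1 _ hz _ hLm.1 hu
          omega)
      have hcase : M.case = 6 := case_eq_six.2 (by omega)
      refine ⟨M, ⟨mem_S2.2 ⟨hM, by omega⟩, hcase⟩, ?_⟩
      rw [hM.psi_of_case_six' hcase (by omega), hr]
    · dsimp only at *
      subst ha hb
      obtain ⟨M, hM, hc, hMx, hr, hs⟩ := hl.exists_bump_eq_of_unique (c := 11) hd (by omega) h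
      have hcase : M.case = 6 := case_eq_six.2 (by omega)
      refine ⟨M, ⟨mem_S2.2 ⟨hM, by omega⟩, hcase⟩, ?_⟩
      rw [hM.psi_of_case_six' hcase (by omega), hr]

end Psi

/-! ### The image of the seventh case of `psi` -/

section PsiSeven

open Marked

theorem SuperDistinctGtOne.add_triple {l : Multiset ℕ} (hl : SuperDistinctGtOne l) {a : ℕ}
    (ha : 1 ≤ a) (h : ∀ z ∈ l, a + 7 ≤ z) : SuperDistinctGtOne (l + {a + 5, a + 3, a + 1}) := by
  have h5 := hl.add_singleton (m := a + 5) (by omega) fun z hz => by have := h z hz; omega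
  have h3 := h5.add_singleton (m := a + 3) (by omega) fun z hz => by
    rcases Multiset.mem_add.1 hz with hz | hz
    · have := h z hz; omega
    · have := Multiset.mem_singleton.1 hz; omega
  have h1 := h3.add_singleton (m := a + 1) (by omega) fun z hz => by
    rcases Multiset.mem_add.1 hz with hz | hz
    · rcases Multiset.mem_add.1 hz with hz | hz
      · have := h z hz; omega
      · have := Multiset.mem_singleton.1 hz; omega
    · have := Multiset.mem_singleton.1 hz; omega
  rwa [add_assoc, add_assoc] at h1

/-- Splits off the three parts that `psi` adjoins when `c` is `1` modulo `3` and no part follows. -/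
theorem SuperDistinctGtOne.exists_eq_add_triple {l : Multiset ℕ}
    (hl : SuperDistinctGtOne l) {a u : ℕ}
    (h1 : a + 1 ∈ l) (h3 : a + 3 ∈ l) (h5 : a + 5 ∈ l)
    (h : ∀ z, z ≤ u → z ≠ a + 1 → z ≠ a + 3 → z ≠ a + 5 → z ∉ l) :
    ∃ r, SuperDistinctGtOne r ∧ (∀ z ∈ r, u < z) ∧ l = r + {a + 5, a + 3, a + 1} := by
  obtain ⟨l, rfl⟩ := Multiset.exists_cons_of_mem h1
  obtain ⟨l, rfl⟩ := Multiset.exists_cons_of_mem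
    ((Multiset.mem_cons.1 h3).resolve_left (by omega))
  obtain ⟨l, rfl⟩ := Multiset.exists_cons_of_mem
    ((Multiset.mem_cons.1 ((Multiset.mem_cons.1 h5).resolve_left (by omega))).resolve_left
      (by omega))
  refine ⟨l, hl.of_le (((Multiset.le_cons_self _ _).trans (Multiset.le_cons_self _ _)).trans
    (Multiset.le_cons_self _ _)), fun z hz => ?_, ?_⟩
  · by_contra hcon
    have hnd := hl.1
    simp only [Multiset.nodup_cons, Multiset.mem_cons, not_or] at hnd
    refine h z (by omega) (fun e => hnd.1.2.2 (e ▸ hz)) (fun e => hnd.2.1.2 (e ▸ hz))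
      (fun e => hnd.2.2.1 (e ▸ hz)) ?_
    simp [hz]
  · simp only [Multiset.insert_eq_cons, ← Multiset.singleton_add]
    abel

theorem psi_mem_I7 {M : Marked} (hM : M.Valid) (hcase : M.case = 7) :
    psi M ∈ I7 M.mu.sum := by
  have hx := hM.x_add_two_le
  have hx0 := hM.x_eq_zero_or
  obtain ⟨h5, hy⟩ := case_eq_seven.1 hcase
  obtain hr | hr | hr : M.c % 3 = 0 ∨ M.c % 3 = 1 ∨ M.c % 3 = 2 := by omega
  · have hs := hM.sum_rest
    have hc2 := hM.two_le
    rw [hM.psi_of_case_seven_zero hcase hr]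
    have hS1 : (⟨M.rest, 3, M.c / 3⟩ : RectPair) ∈ S1 M.mu.sum :=
      ⟨hM.superDistinct_rest, Or.inr rfl, by dsimp only; omega, by dsimp only; omega⟩
    by_cases h0 : M.x = 0
    · refine Or.inl (Or.inl (Or.inr ⟨hS1, rfl, by dsimp only; omega, fun z hz hmem => ?_⟩))
      dsimp only at hz hmem
      have := hM.rest_cases hmem
      omega
    · refine Or.inl (Or.inl (Or.inl (Or.inl (Or.inl ⟨hS1, rfl, by dsimp only; omega,
        hM.notMem_rest (by dsimp only; omega) (by dsimp only; omega),
        hM.notMem_rest (by dsimp only; omega) (by dsimp only; omega),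
        hM.notMem_rest (by dsimp only; omega) (by dsimp only; omega),
        hM.notMem_rest (by dsimp only; omega) (by dsimp only; omega),
        hM.notMem_rest (by dsimp only; omega) (by dsimp only; omega),
        M.x, hM.mem_rest.2 ⟨(x_mem h0).1, by omega⟩, by dsimp only; omega⟩))))
  · by_cases h0 : M.x = 0
    · have hc2 := hM.two_le
      have hs := hM.sum_rest
      rw [psi_of_case_seven_one' hcase hr h0]
      obtain ⟨a, ha⟩ : ∃ a, a = 5 * (M.c / 20 - 1) + 3 := ⟨_, rfl⟩
      rw [← ha, show 5 * (M.c / 20 - 1) + 8 = a + 5 by omega,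
        show 5 * (M.c / 20 - 1) + 6 = a + 3 by omega, show 5 * (M.c / 20 - 1) + 4 = a + 1 by omega]
      refine Or.inr ⟨⟨hM.superDistinct_rest.add_triple (by omega) fun z hz => ?_,
        Or.inr (by dsimp only; omega), le_rfl, ?_⟩, rfl, by dsimp only; omega, by simp, by simp,
        by simp, fun z hz hz1 hz3 hz5 hmem => ?_⟩
      · have := hM.rest_cases hz; omega
      · simp only [Multiset.sum_add, Multiset.insert_eq_cons, Multiset.sum_cons,
          Multiset.sum_singleton]
        omega
      · dsimp only at hz hz1 hz3 hz5 hmem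
        simp only [Multiset.mem_add, Multiset.insert_eq_cons, Multiset.mem_cons,
          Multiset.mem_singleton] at hmem
        have := hM.rest_cases (hmem.resolve_right (by omega))
        omega
    · have hs := hM.sum_bump 1
      rw [psi_of_case_seven_one hcase hr h0]
      refine Or.inl (Or.inl (Or.inl (Or.inl (Or.inr
        ⟨⟨hM.superDistinct_bump (by omega) (by omega), Or.inr rfl, by dsimp only; omega,
        by dsimp only; omega⟩, rfl, by dsimp only; omega, by dsimp only; omega,
        hM.notMem_bump (by dsimp only; omega) (by dsimp only; omega) (by dsimp only; omega),
        hM.notMem_bump (by dsimp only; omega) (by dsimp only; omega) (by dsimp only; omega),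
        hM.notMem_bump (by dsimp only; omega) (by dsimp only; omega) (by dsimp only; omega),
        hM.notMem_bump (by dsimp only; omega) (by dsimp only; omega) (by dsimp only; omega), ?_⟩))))
      dsimp only
      rw [hM.largestLE_bump (by omega) (by omega)]
      exact ⟨by omega, hM.notMem_bump (by omega) (by omega) (by omega)⟩
  · have hs := hM.sum_bump 2
    have hmem := hM.x_add_mem_bump 2
    rw [hM.psi_of_case_seven_two hcase hr]
    have hS1 : (⟨M.bump 2, 3, M.c / 3⟩ : RectPair) ∈ S1 M.mu.sum :=
      ⟨hM.superDistinct_bump (by omega) (by omega), Or.inr rfl, by dsimp only; omega,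
        by dsimp only; omega⟩
    by_cases h0 : M.x = 0
    · refine Or.inl (Or.inr ⟨hS1, rfl, by dsimp only; omega, ?_, fun z hz hne => ?_⟩)
      · rwa [h0, zero_add] at hmem
      · dsimp only at hz hne
        exact hM.notMem_bump (by omega) (by omega) (by omega)
    · refine Or.inl (Or.inl (Or.inl (Or.inr ⟨hS1, rfl, by dsimp only; omega,
        hM.notMem_bump (by dsimp only; omega) (by dsimp only; omega) (by dsimp only; omega),
        hM.notMem_bump (by dsimp only; omega) (by dsimp only; omega) (by dsimp only; omega),
        hM.notMem_bump (by dsimp only; omega) (by dsimp only; omega) (by dsimp only; omega), ?_⟩)))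
      dsimp only
      rw [hM.largestLE_bump (by omega) (by omega)]
      exact ⟨by omega, hM.notMem_bump (by omega) (by omega) (by omega),
        hM.notMem_bump (by omega) (by omega) (by omega)⟩

theorem image_case_seven (n : ℕ) : psi '' {M | M ∈ S2 n ∧ M.case = 7} = I7 n := by
  ext t
  constructor
  · rintro ⟨M, ⟨hM, hcase⟩, rfl⟩
    obtain ⟨hV, rfl⟩ := mem_S2.1 hM
    exact psi_mem_I7 hV hcase
  · obtain ⟨l, a, b⟩ := t
    -- the two forms in which `c = 3 b` is just added to `l`
    have key : SuperDistinctGtOne l → b % 20 = 7 → l.sum + 3 * b = n →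
        (∀ z ∈ l, z + 4 ≤ 3 * b ∨ 3 * b + 2 ≤ z) →
        ∃ M, (M ∈ S2 n ∧ M.case = 7) ∧ psi M = ⟨l, 3, b⟩ := by
      intro hl hb hn hz
      obtain ⟨M, hM, hc, hr, hs⟩ := exists_rest_eq hl (c := 3 * b) (by omega) fun z hmem => by
        have := hz z hmem; omega
      have hxM : M.x + 4 ≤ 3 * b := by
        by_cases h0 : M.x = 0
        · omega
        · have hxm := x_mem h0
          have := hz M.x (hr ▸ hM.mem_rest.2 ⟨hxm.1, hxm.2.ne⟩)
          omega
      have hcase : M.case = 7 := case_eq_seven.2 (by omega)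
      refine ⟨M, ⟨mem_S2.2 ⟨hM, by omega⟩, hcase⟩, ?_⟩
      rw [hM.psi_of_case_seven_zero hcase (by omega), hr, show M.c / 3 = b by omega]
    rintro (((((⟨⟨hl, -, -, hn⟩, ha, hb, h1, h2, h3, h4, h5, -⟩ |
      ⟨⟨hl, -, -, hn⟩, ha, hb, hb0, h1, h2, h3, h4, hL, hL2⟩) |
      ⟨⟨hl, -, -, hn⟩, ha, hb, h1, h2, h3, hL, hL2, hL3⟩) |
      ⟨⟨hl, -, -, hn⟩, ha, hb, h⟩) | ⟨⟨hl, -, -, hn⟩, ha, hb, hd, h⟩) |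
      ⟨⟨hl, -, -, hn⟩, hb, ha, h1, h3, h5, h⟩) <;> dsimp only at *
    · subst ha
      refine key hl hb hn fun z hz => ?_
      have := ne_of_mem_of_not_mem hz h1
      have := ne_of_mem_of_not_mem hz h2
      have := ne_of_mem_of_not_mem hz h3
      have := ne_of_mem_of_not_mem hz h4
      have := ne_of_mem_of_not_mem hz h5
      omega
    · subst ha
      have hLm := largestLE_mem (l := l) (u := 3 * b - 2) (by omega)
      obtain ⟨M, hM, hc, hMx, hr, hs⟩ := hl.exists_bump_eq_of_largestLE (c := 3 * b + 1) (d := 1)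
        hL (by omega)
        (fun z hz hu => by
          have := ne_of_mem_of_not_mem hz h1
          have := ne_of_mem_of_not_mem hz h2
          have := ne_of_mem_of_not_mem hz h3
          have := ne_of_mem_of_not_mem hz h4
          omega)
        (fun z hz hu => by
          have := ne_of_mem_of_not_mem hz hL2
          have := hl.2.1 _ hz _ hLm.1 hu
          omega)
      have hcase : M.case = 7 := case_eq_seven.2 (by omega)
      refine ⟨M, ⟨mem_S2.2 ⟨hM, by omega⟩, hcase⟩, ?_⟩
      rw [psi_of_case_seven_one hcase (by omega) (by omega), hr, show M.c / 3 = b by omega]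
    · subst ha
      have hLm := largestLE_mem (l := l) (u := 3 * b) (by omega)
      obtain ⟨M, hM, hc, hMx, hr, hs⟩ := hl.exists_bump_eq_of_largestLE (c := 3 * b + 2) (d := 2)
        hL (by omega)
        (fun z hz hu => by
          have := ne_of_mem_of_not_mem hz h1
          have := ne_of_mem_of_not_mem hz h2
          have := ne_of_mem_of_not_mem hz h3
          omega)
        (fun z hz hu => by
          have := ne_of_mem_of_not_mem hz hL2
          have := ne_of_mem_of_not_mem hz hL3
          have := hl.2.1 _ hz _ hLm.1 hu
          omega)
      have hcase : M.case = 7 := case_eq_seven.2 (by omega)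
      refine ⟨M, ⟨mem_S2.2 ⟨hM, by omega⟩, hcase⟩, ?_⟩
      rw [hM.psi_of_case_seven_two hcase (by omega), hr, show M.c / 3 = b by omega]
    · subst ha
      refine key hl hb hn fun z hz => Or.inr ?_
      by_contra hcon
      exact h z (by omega) hz
    · subst ha
      obtain ⟨M, hM, hc, hMx, hr, hs⟩ :=
        hl.exists_bump_eq_of_unique (c := 3 * b + 2) hd (by omega) h
      have hcase : M.case = 7 := case_eq_seven.2 (by omega)
      refine ⟨M, ⟨mem_S2.2 ⟨hM, by omega⟩, hcase⟩, ?_⟩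
      rw [hM.psi_of_case_seven_two hcase (by omega), hr, show M.c / 3 = b by omega]
    · subst hb
      obtain ⟨r, hrS, hru, rfl⟩ := hl.exists_eq_add_triple h1 h3 h5 h
      obtain ⟨M, hM, hc, hr, hs⟩ := exists_rest_eq hrS (c := 4 * a + 9) (by omega) fun z hz => by
        have := hru z hz; omega
      have hMx : M.x = 0 := by
        by_contra h0
        have hxm := x_mem h0
        have := hru M.x (hr ▸ hM.mem_rest.2 ⟨hxm.1, hxm.2.ne⟩)
        omega
      have hcase : M.case = 7 := case_eq_seven.2 (by omega)
      simp only [Multiset.sum_add, Multiset.insert_eq_cons, Multiset.sum_cons,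
        Multiset.sum_singleton] at hn
      refine ⟨M, ⟨mem_S2.2 ⟨hM, by omega⟩, hcase⟩, ?_⟩
      rw [psi_of_case_seven_one' hcase (by omega) hMx, hr,
        show 5 * (M.c / 20 - 1) + 8 = a + 5 by omega,
        show 5 * (M.c / 20 - 1) + 6 = a + 3 by omega, show 5 * (M.c / 20 - 1) + 4 = a + 1 by omega,
        show 5 * (M.c / 20 - 1) + 3 = a by omega]

end PsiSeven

theorem image_case (n : ℕ) : ∀ j ∈ Finset.Icc 1 7,
    psi '' {M | M ∈ S2 n ∧ M.case = j} = I j n := by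
  intro j hj
  obtain ⟨h1, h7⟩ := Finset.mem_Icc.1 hj
  interval_cases j
  · exact image_case_one n
  · exact image_case_two n
  · exact image_case_three n
  · exact image_case_four n
  · exact image_case_five n
  · exact image_case_six n
  · exact image_case_seven n

/-! ### Injectivity of `psi` -/

section Injectivity

open Marked

theorem Marked.Valid.psi_shape_of_case_seven {M : Marked} (hM : M.Valid) (h : M.case = 7) :
    ((psi M).a = 3 ∧ (psi M).b = M.c / 3) ∨
      ((psi M).a = 5 * (M.c / 20 - 1) + 3 ∧ (psi M).b = 1) := by
  obtain hr | hr | hr : M.c % 3 = 0 ∨ M.c % 3 = 1 ∨ M.c % 3 = 2 := by omega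
  · rw [hM.psi_of_case_seven_zero h hr]; exact Or.inl ⟨rfl, rfl⟩
  · by_cases hx : M.x = 0
    · rw [psi_of_case_seven_one' h hr hx]; exact Or.inr ⟨rfl, rfl⟩
    · rw [psi_of_case_seven_one h hr hx]; exact Or.inl ⟨rfl, rfl⟩
  · rw [hM.psi_of_case_seven_two h hr]; exact Or.inl ⟨rfl, rfl⟩

/-- Within one case of `psi`, the rectangle determines the marked part. -/
theorem Marked.eq_of_psi_eq {M M' : Marked} (hM : M.Valid) (hM' : M'.Valid)
    (hcase : M.case = M'.case) (h : psi M = psi M') : M = M' := by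
  have hx := hM.x_add_two_le
  have hx' := hM'.x_add_two_le
  have h7 := Finset.mem_Icc.1 M.case_mem_Icc
  obtain ⟨j, hj⟩ : ∃ j, M.case = j := ⟨_, rfl⟩
  have hj' : M'.case = j := hcase ▸ hj
  rw [hj] at h7
  obtain ⟨h1, h7⟩ := h7
  interval_cases j
  · have e := case_eq_one.1 hj
    have e' := case_eq_one.1 hj'
    rw [psi_of_case_one hj, psi_of_case_one hj', RectPair.mk.injEq] at h
    exact hM.eq_of_rest_eq hM' (by omega) h.1
  · rw [psi_of_case_two hj, psi_of_case_two hj', RectPair.mk.injEq] at h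
    exact hM.eq_of_rest_eq hM' h.2.1 h.1
  · have e := case_eq_three.1 hj
    have e' := case_eq_three.1 hj'
    rw [psi_of_case_three hj, psi_of_case_three hj', RectPair.mk.injEq] at h
    exact hM.eq_of_bump_eq hM' (by omega) (by omega) (by omega) h.1
  · have e := case_eq_four.1 hj
    have e' := case_eq_four.1 hj'
    by_cases h0 : M.x = 0 <;> by_cases h0' : M'.x = 0
    · rw [hM.psi_of_case_four hj h0, hM'.psi_of_case_four hj' h0', RectPair.mk.injEq] at h
      have hc : M.c = M'.c := by omega
      rw [hc] at h
      exact hM.eq_of_bump_eq hM' hc (by omega) (by omega) h.1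
    · rw [hM.psi_of_case_four hj h0, psi_of_case_four hj' h0', RectPair.mk.injEq] at h
      omega
    · rw [psi_of_case_four hj h0, hM'.psi_of_case_four hj' h0', RectPair.mk.injEq] at h
      omega
    · rw [psi_of_case_four hj h0, psi_of_case_four hj' h0', RectPair.mk.injEq] at h
      exact hM.eq_of_bump_eq hM' (by omega) (by omega) (by omega) h.1
  · have e := case_eq_five.1 hj
    have e' := case_eq_five.1 hj'
    rw [hM.psi_of_case_five hj, hM'.psi_of_case_five hj', RectPair.mk.injEq] at h
    exact hM.eq_of_bump_eq hM' (by omega) (by omega) (by omega) h.1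
  · have e := case_eq_six.1 hj
    have e' := case_eq_six.1 hj'
    by_cases h0 : 0 < M.c / 20 <;> by_cases h0' : 0 < M'.c / 20
    · rw [hM.psi_of_case_six hj h0, hM'.psi_of_case_six hj' h0', RectPair.mk.injEq] at h
      exact hM.eq_of_bump_eq hM' (by omega) (by omega) (by omega) h.1
    · rw [hM.psi_of_case_six hj h0, hM'.psi_of_case_six' hj' h0', RectPair.mk.injEq] at h
      omega
    · rw [hM.psi_of_case_six' hj h0, hM'.psi_of_case_six hj' h0', RectPair.mk.injEq] at h
      omega
    · rw [hM.psi_of_case_six' hj h0, hM'.psi_of_case_six' hj' h0', RectPair.mk.injEq] at h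
      exact hM.eq_of_bump_eq hM' (by omega) (by omega) (by omega) h.1
  · have e := case_eq_seven.1 hj
    have e' := case_eq_seven.1 hj'
    have hc2 := hM.two_le
    have hc2' := hM'.two_le
    -- since `c` is `1` modulo `20`, the quotient `c / 3` or the part size determines it
    have hc : M.c = M'.c := by
      have k := hM.psi_shape_of_case_seven hj
      have k' := hM'.psi_shape_of_case_seven hj'
      rw [h] at k
      omega
    obtain hr | hr | hr : M.c % 3 = 0 ∨ M.c % 3 = 1 ∨ M.c % 3 = 2 := by omega
    · rw [hM.psi_of_case_seven_zero hj hr, hM'.psi_of_case_seven_zero hj' (hc ▸ hr),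
        RectPair.mk.injEq] at h
      exact hM.eq_of_rest_eq hM' hc h.1
    · by_cases h0 : M.x = 0 <;> by_cases h0' : M'.x = 0
      · rw [psi_of_case_seven_one' hj hr h0, psi_of_case_seven_one' hj' (hc ▸ hr) h0',
          RectPair.mk.injEq, hc] at h
        exact hM.eq_of_rest_eq hM' hc (add_right_cancel h.1)
      · rw [psi_of_case_seven_one' hj hr h0, psi_of_case_seven_one hj' (hc ▸ hr) h0',
          RectPair.mk.injEq] at h
        omega
      · rw [psi_of_case_seven_one hj hr h0, psi_of_case_seven_one' hj' (hc ▸ hr) h0',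
          RectPair.mk.injEq] at h
        omega
      · rw [psi_of_case_seven_one hj hr h0, psi_of_case_seven_one hj' (hc ▸ hr) h0',
          RectPair.mk.injEq] at h
        exact hM.eq_of_bump_eq hM' hc (by omega) (by omega) h.1
    · rw [hM.psi_of_case_seven_two hj hr, hM'.psi_of_case_seven_two hj' (hc ▸ hr),
        RectPair.mk.injEq] at h
      exact hM.eq_of_bump_eq hM' hc (by omega) (by omega) h.1

end Injectivity

/-! ### Disjointness of the images, and the count -/

theorem I_subset_S1 {n j : ℕ} : I j n ⊆ S1 n := by
  intro t ht
  unfold I at ht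
  split at ht
  · exact ht.1
  · exact ht.1
  · rcases ht with ht | ht <;> exact ht.1
  · rcases ht with ht | ht <;> exact ht.1
  · rcases ht with ht | ht <;> exact ht.1
  · rcases ht with ((ht | ht) | ht) | ht <;> exact ht.1
  · rcases ht with ((((ht | ht) | ht) | ht) | ht) | ht <;> exact ht.1
  · exact ht.elim

theorem I_disjoint_of_lt {n i j : ℕ} (hi : 1 ≤ i) (hj : j ≤ 7) (hij : i < j) :
    Disjoint (I i n) (I j n) := by
  rw [Set.disjoint_left]
  rintro ⟨l, a, b⟩ h h'
  -- most pairs of forms are told apart by the residues and sizes of `a` and `b`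
  interval_cases j <;> interval_cases i <;>
    simp only [I, I1, I2, I3, I4, I5, I6, I7, S1, CongPmTwo, Set.mem_union,
      Set.mem_ofPred_eq] at h h' <;> try omega
  · obtain ⟨-, -, h1, h2, -⟩ := h
    rcases h' with ⟨-, -, -, -, h', -⟩ | ⟨-, -, -, -, h', -⟩
    · exact h2 h'
    · exact h1 h'
  · obtain ⟨-, ha, -, -, h3⟩ := h
    rcases h' with h' | ⟨-, hb, -, h', -⟩
    · omega
    · subst ha hb
      exact h3 h'
  · obtain ⟨-, hb, -, -, -, h3⟩ := h
    rcases h' with h' | ⟨-, -, -, h', -⟩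
    · omega
    · exact h3 h'
  · obtain ⟨-, hb, -, -, -, h3⟩ := h
    rcases h' with h' | ⟨-, -, -, h', -⟩
    · omega
    · exact h3 h'

end RRParts

theorem theorem4p1 (n : ℕ) :
    (RRParts.S n).Finite ∧
    (RRParts.numPartsCong n : ℤ) - (RRParts.numPartsSuper n : ℤ) = ((RRParts.S n).ncard : ℤ) ∧
    Set.MapsTo RRParts.psi (RRParts.S2 n) (RRParts.S1 n) ∧
    Set.InjOn RRParts.psi (RRParts.S2 n) ∧
    (∀ j ∈ Finset.Icc 1 7,
      RRParts.psi '' {M | M ∈ RRParts.S2 n ∧ M.case = j} = RRParts.I j n) ∧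
    (∀ i ∈ Finset.Icc 1 7, ∀ j ∈ Finset.Icc 1 7, i ≠ j →
      Disjoint (RRParts.I i n) (RRParts.I j n)) := by
  open RRParts in
  have hdisj : ∀ i ∈ Finset.Icc 1 7, ∀ j ∈ Finset.Icc 1 7, i ≠ j →
      Disjoint (I i n) (I j n) := by
    intro i hi j hj hij
    rw [Finset.mem_Icc] at hi hj
    rcases Nat.lt_or_gt_of_ne hij with h | h
    · exact I_disjoint_of_lt hi.1 hj.2 h
    · exact (I_disjoint_of_lt hj.1 hi.2 h).symm
  have hmem : ∀ M ∈ S2 n, psi M ∈ I M.case n := fun M hM => by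
    rw [← image_case n M.case M.case_mem_Icc]
    exact ⟨M, ⟨hM, rfl⟩, rfl⟩
  have hunion : psi '' S2 n = ⋃ j ∈ Finset.Icc 1 7, I j n := by
    ext t
    simp only [Set.mem_iUnion, exists_prop]
    constructor
    · rintro ⟨M, hM, rfl⟩
      exact ⟨M.case, M.case_mem_Icc, hmem M hM⟩
    · rintro ⟨j, hj, ht⟩
      rw [← image_case n j hj] at ht
      obtain ⟨M, hM, rfl⟩ := ht
      exact ⟨M, hM.1, rfl⟩
  have hsub : ∀ j, I j n ⊆ S1 n := fun j t ht => I_subset_S1 ht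
  have hmaps : Set.MapsTo psi (S2 n) (S1 n) := fun M hM => hsub _ (hmem M hM)
  have hinj : Set.InjOn psi (S2 n) := by
    intro M hM M' hM' h
    refine Marked.eq_of_psi_eq (Marked.mem_S2.1 hM).1 (Marked.mem_S2.1 hM').1 ?_ h
    by_contra hne
    exact Set.disjoint_left.1 (hdisj _ M.case_mem_Icc _ M'.case_mem_Icc hne) (hmem M hM)
      (h ▸ hmem M' hM')
  have hfin : (S1 n).Finite := S1_finite n
  refine ⟨hfin.subset Set.sdiff_subset, ?_, hmaps, hinj, image_case n, hdisj⟩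
  rw [S, ← hunion, numPartsCong_eq_ncard_S1, numPartsSuper_eq_ncard_S2,
    Set.cast_ncard_sdiff hmaps.image_subset hfin, hinj.ncard_image]
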